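/- **Theorem (Unstable flat-core pinned $p$-elasticae).** Let $p\in(2,\infty)$, $L>0$ and $P_0,P_1\in\mathbf{R}^2$ with $|P_0-P_1|<L$. Let $$\mathcal{A}_{\mathrm{pin}}:=\{\gamma\in W^{2,p}(0,L;\mathbf{R}^2) : |\gamma'|\equiv 1,\ \gamma(0)=P_0,\ \gamma(L)=P_1\}$$ be equipped with the topology induced by the $W^{2,p}$-norm, and let $\mathcal{B}_p[\gamma]:=\int_0^L|k|^p\,ds$, where $k$ is the signed curvature of $\gamma$. A curve $\gamma\in\mathcal{A}_{\mathrm{pin}}$ is called *unstable* if it is not a local minimizer of $\mathcal{B}_p$ in $\mathcal{A}_{\mathrm{pin}}$. *Flat-core $p$-elasticae.* Let $F_p(x):=\int_0^x|\cos t|^{-2/p}\,dt$, $K_p:=F_p(\pi/2)<\infty$, and let $\mathrm{am}_p:[-K_p,K_p]\to[-\frac{\pi}{2},\frac{\pi}{2}]$ be the inverse of $F_p$. Let $\gamma_{\mathrm{loop}}^+:[0,2K_p]\to\mathbf{R}^2$ be the arclength parametrized curve that starts at the origin and has tangential angle $\theta(s)=\pi+2\,\mathrm{am}_p(s-K_p)$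 (which increases from $0$ to $2\pi$), and let $\gamma_{\mathrm{loop}}^-$ be its reflection in the $e_1$-axis. For $a\ge0$ let $\gamma_{\mathrm{seg}}^{a}(s):=(s,0)$, $s\in[0,a]$. Let $\oplus$ denote concatenation of curves, the second curve being translated so that it starts where the first one ends. A curve $\gamma:[0,L]\to\mathbf{R}^2$ is a *flat-core $p$-elastica* if, up to similarity and arclength reparametrization, it is the restriction to a subinterval of $$\gamma_{\mathrm{seg}}^{L_0}\oplus\bigoplus_{j=1}^N\big(\gamma_{\mathrm{loop}}^{\sigma_j}\oplus\gamma_{\mathrm{seg}}^{L_j}\big)$$ for some $N\in\mathbf{N}$, $\sigma_1,\dots,\sigma_N\in\{+,-\}$ and $L_0,\dots,L_N\ge0$. Its loops are the pieces $\gamma_{\mathrm{loop}}^{\sigma_j}$ that lie entirely in that subinterval. *Claim.* Let $\gamma\in\mathcal{A}_{\mathrm{pin}}$ be a flat-core $p$-elastica (in particular, any critical point of $\mathcal{B}_p$ in $\mathcal{A}_{\mathrm{pin}}$ that is a flat-core $p$-elastica). Then $\gamma$ is unstable if at least one of the following holds: 1. $\gamma$ contains two adjacent loops in opposite directions with no segment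 between them, i.e. for some $1\le j\le N-1$ the $j$-th and $(j+1)$-th loops are both loops of $\gamma$, $L_j=0$ and $\sigma_j\ne\sigma_{j+1}$; 2. a loop of $\gamma$ touches an endpoint, i.e. some loop of $\gamma$ begins at $\gamma(0)$ at parameter $0$ or ends at $\gamma(L)$ at parameter $L$. -/

import Mathlib

/-!  Planar curves are maps into `ℂ`, the Euclidean plane; a curve of length `L` is a function on `ℝ`
of which only the values on `[0, L]` matter. -/

namespace FlatCore

open Real MeasureTheory Set

noncomputable section

/-! ### Sobolev curves, the pinned admissible class and the bending energy -/

/-- The first derivative `γ'` on `[0, L]` (one-sided at the endpoints). -/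
def d1 (L : ℝ) (γ : ℝ → ℂ) : ℝ → ℂ := derivWithin γ (Icc 0 L)

/-- The second derivative `γ''` on `[0, L]`. For a curve in `W^{2,p}` it exists almost everywhere
and is the second weak derivative. -/
def d2 (L : ℝ) (γ : ℝ → ℂ) : ℝ → ℂ := derivWithin (d1 L γ) (Icc 0 L)

/-- `γ ∈ W^{2,p}(0, L; ℝ²)`, in the standard one-dimensional form: the (continuously differentiable
representative of the) curve has an absolutely continuous derivative, and the second derivative
is in `L^p`. -/
structure MemW2p (p L : ℝ) (γ : ℝ → ℂ) : Prop where
  differentiableOn : DifferentiableOn ℝ γ (Icc 0 L)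
  absolutelyContinuous : AbsolutelyContinuousOnInterval (d1 L γ) 0 L
  memLp : MemLp (d2 L γ) (ENNReal.ofReal p) (volume.restrict (Icc 0 L))

/-- The distance of two curves in the `W^{2,p}(0, L; ℝ²)` norm. -/
def w2pDist (p L : ℝ) (γ ξ : ℝ → ℂ) : ENNReal :=
  eLpNorm (fun s => γ s - ξ s) (ENNReal.ofReal p) (volume.restrict (Icc 0 L)) +
  eLpNorm (fun s => d1 L γ s - d1 L ξ s) (ENNReal.ofReal p) (volume.restrict (Icc 0 L)) +
  eLpNorm (fun s => d2 L γ s - d2 L ξ s) (ENNReal.ofReal p) (volume.restrict (Icc 0 L))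

/-- The pinned admissible class: curves in `W^{2,p}` parametrized by arclength on `[0, L]` with
prescribed endpoints (and free tangent directions there). -/
def pinnedClass (p L : ℝ) (P₀ P₁ : ℂ) : Set (ℝ → ℂ) :=
  {γ | MemW2p p L γ ∧ (∀ s ∈ Icc 0 L, ‖d1 L γ s‖ = 1) ∧ γ 0 = P₀ ∧ γ L = P₁}

/-- The signed curvature `det (γ', γ'')` of a curve parametrized by arclength. -/
def signedCurvature (L : ℝ) (γ : ℝ → ℂ) (s : ℝ) : ℝ :=
  (starRingEnd ℂ (d1 L γ s) * d2 L γ s).im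

/-- The `p`-bending energy `∫₀ᴸ |k|^p ds`. -/
def bendingEnergy (p L : ℝ) (γ : ℝ → ℂ) : ℝ :=
  ∫ s in (0 : ℝ)..L, |signedCurvature L γ s| ^ p

/-- Stability: `γ` is a local minimizer of the `p`-bending energy in the pinned class, with respect
to the topology of the `W^{2,p}` norm. -/
def IsStable (p L : ℝ) (P₀ P₁ : ℂ) (γ : ℝ → ℂ) : Prop :=
  γ ∈ pinnedClass p L P₀ P₁ ∧ ∃ δ : ENNReal, 0 < δ ∧
    ∀ ξ ∈ pinnedClass p L P₀ P₁, w2pDist p L γ ξ < δ → bendingEnergy p L γ ≤ bendingEnergy p L ξ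

/-! ### The loop

The curvature of the loop is the compactly supported "hyperbolic secant" profile
`2 sech_p = 2 cos (am_p) ^ (2 / p)`, that is, the tangential angle is `2 am_p` up to a constant, where
`am_p` is the amplitude function of modulus `1`. -/

/-- The incomplete `p`-elliptic integral of the first kind of modulus `1`. -/
def ellipticF (p x : ℝ) : ℝ := ∫ t in (0 : ℝ)..x, |cos t| ^ (-(2 / p))

/-- The complete `p`-elliptic integral of modulus `1`; finite exactly for `p > 2`. -/
def ellipticK (p : ℝ) : ℝ := ellipticF p (π / 2)

/-- The amplitude function `am_p : [-K_p, K_p] → [-π/2, π/2]`, the inverse of `ellipticF p`. -/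
def am (p : ℝ) : ℝ → ℝ := Function.invFunOn (ellipticF p) (Icc (-(π / 2)) (π / 2))

/-- The tangential angle of the positive loop at arclength `s ∈ [0, 2 K_p]`; it increases from
`0` to `2 π`. -/
def loopAngle (p s : ℝ) : ℝ := π + 2 * am p (s - ellipticK p)

/-- A parametrized curve `[0, len] → ℝ²`. -/
structure Curve where
  len : ℝ
  toFun : ℝ → ℂ

/-- The concatenation `γ₁ ⊕ γ₂`: the second curve is translated so as to start where the first
one ends. -/
def Curve.append (γ₁ γ₂ : Curve) : Curve where
  len := γ₁.len + γ₂.len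
  toFun s := if s ≤ γ₁.len then γ₁.toFun s
    else γ₂.toFun (s - γ₁.len) + γ₁.toFun γ₁.len - γ₂.toFun 0

/-- The horizontal segment `s ↦ (s, 0)` of length `a`. -/
def seg (a : ℝ) : Curve where
  len := a
  toFun s := (s : ℂ)

/-- The loop `γ_loop^σ`, `σ = ±1`, parametrized by arclength: the positive (counterclockwise) loop
for `σ = 1`, and its reflection in the horizontal axis for `σ = -1`. -/
def loop (p : ℝ) (σ : ℤˣ) : Curve where
  len := 2 * ellipticK p
  toFun s := if σ = 1
    then ∫ t in (0 : ℝ)..s, Complex.exp (Complex.I * (loopAngle p t : ℂ))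
    else starRingEnd ℂ (∫ t in (0 : ℝ)..s, Complex.exp (Complex.I * (loopAngle p t : ℂ)))

/-- `seg ℓ₀ ⊕ loop σ₀ ⊕ seg ℓ₁ ⊕ loop σ₁ ⊕ ⋯ ⊕ loop σ_{N-1} ⊕ seg ℓ_N`. -/
def chain (p : ℝ) (σ : ℕ → ℤˣ) (ℓ : ℕ → ℝ) : ℕ → Curve
  | 0 => seg (ℓ 0)
  | n + 1 => (chain p σ ℓ n).append ((loop p (σ n)).append (seg (ℓ (n + 1))))

/-! ### Flat-core `p`-elasticae -/

/-- A presentation of `γ : [0, L] → ℝ²` as a flat-core `p`-elastica: up to similarity (with ratio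
`scale⁻¹`) and arclength reparametrization, `γ` is the part over `[start, start + scale * L]` of a
concatenation of `numLoops` loops of signs `σ` and segments of lengths `ℓ ≥ 0`. -/
structure Presentation (p L : ℝ) (γ : ℝ → ℂ) where
  numLoops : ℕ
  σ : ℕ → ℤˣ
  ℓ : ℕ → ℝ
  ℓ_nonneg : ∀ i, 0 ≤ ℓ i
  start : ℝ
  scale : ℝ
  scale_pos : 0 < scale
  start_nonneg : 0 ≤ start
  stop_le : start + scale * L ≤ (chain p σ ℓ numLoops).len
  rot : ℂ ≃ₗᵢ[ℝ] ℂ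
  shift : ℂ
  eq_chain : ∀ s ∈ Icc 0 L,
    γ s = scale⁻¹ • rot ((chain p σ ℓ numLoops).toFun (start + scale * s)) + shift

namespace Presentation

variable {p L : ℝ} {γ : ℝ → ℂ}

/-- The parameter of the concatenation at which the `j`-th loop begins (`j = 0, 1, …`). -/
def loopStart (D : Presentation p L γ) (j : ℕ) : ℝ := (chain p D.σ D.ℓ j).len

/-- The parameter of the concatenation at which the `j`-th loop ends. -/
def loopStop (D : Presentation p L γ) (j : ℕ) : ℝ := D.loopStart j + (loop p (D.σ j)).len

/-- The curve `γ` contains the whole `j`-th loop. -/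
def ContainsLoop (D : Presentation p L γ) (j : ℕ) : Prop :=
  j < D.numLoops ∧ D.start ≤ D.loopStart j ∧ D.loopStop j ≤ D.start + D.scale * L

/-- The curve contains two adjacent loops in opposite directions, the segment between them having
length zero. -/
def HasAdjacentOppositeLoops (D : Presentation p L γ) : Prop :=
  ∃ j, D.ContainsLoop j ∧ D.ContainsLoop (j + 1) ∧ D.ℓ (j + 1) = 0 ∧ D.σ j ≠ D.σ (j + 1)

/-- One of the loops of the curve begins at its initial point or ends at its terminal point. -/
def LoopTouchesEndpoint (D : Presentation p L γ) : Prop :=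
  ∃ j, D.ContainsLoop j ∧
    (D.loopStart j = D.start ∨ D.loopStop j = D.start + D.scale * L)

end Presentation

end

end FlatCore

namespace FlatCore

open Real MeasureTheory Set Filter Topology

/-! A loop is not energy minimizing once its initial tangent may rotate. Along the loop the
tangential angle θ satisfies θ' = k with k^p = 2^(p-1) (1 - cos θ) (`turnRate_rpow`). Cut off the
initial arc of length ε and append a segment of length ε at the end, where the tangent is horizontal
and the curvature is zero. The length is kept, the energy drops by 2^(p-1) δ with δ = ∫₀^ε (1 - cos
θ), and the endpoint moves by (δ, -η) with η = ∫₀^ε sin θ.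

The endpoint is brought back by changing the arclength element to (1 + w) du, where w du = F(θ) dθ.
This moves the endpoint by exactly (∫ F cos, ∫ F sin), keeps the length when F has mean zero, and
changes the energy to first order by (p-1) 2^(p-1) ∫ F cos. With moments (-δ, η) it lowers the
energy again, and the vertical correction is free at this order. The total first-order change is -p
2^(p-1) δ. The remainder is quadratic in δ + |η|, and η² ≤ 2εδ by Cauchy-Schwarz, so it is O(εδ) and
loses for small ε. This is `exists_moments`, `exists_inner_variation` and
`exists_angle_of_less_energy`.

Rotation of the initial tangent is allowed in both cases of the theorem. At an endpoint of a pinned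
curve the tangent is free. At the junction of two opposite loops the tangential angle is, modulo 2π,
an even function of the arclength x from the junction, namely τ Θ(|x|) with Θ the loop angle;
replacing Θ by the new angle on both sides keeps the tangent continuous. The curvature may jump
there, which W^{2,p} permits. `not_isStable_of_local` treats all cases at once: each side of the
touching point contains a whole loop or is empty. -/

/-- A function which is differentiable near a point except at the point itself, with a derivative
extending continuously, is differentiable at the point. -/
theorem hasDerivAt_of_eventually_ne {f g : ℝ → ℝ} {x : ℝ}
    (h : ∀ᶠ y in 𝓝[≠] x, HasDerivAt f (g y) y) (hf : ContinuousAt f x) (hg : ContinuousAt g x) :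
    HasDerivAt f (g x) x := by
  rw [eventually_nhdsWithin_iff, Metric.eventually_nhds_iff] at h
  obtain ⟨ε, hε, h⟩ := h
  have hR : ∀ y ∈ Ioo x (x + ε), HasDerivAt f (g y) y := fun y hy =>
    h (by rw [Real.dist_eq, abs_lt]; constructor <;> linarith [hy.1, hy.2]) hy.1.ne'
  have hL : ∀ y ∈ Ioo (x - ε) x, HasDerivAt f (g y) y := fun y hy =>
    h (by rw [Real.dist_eq, abs_lt]; constructor <;> linarith [hy.1, hy.2]) hy.2.ne
  have A : HasDerivWithinAt f (g x) (Ici x) x := by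
    refine hasDerivWithinAt_Ici_of_tendsto_deriv (s := Ioo x (x + ε))
      (fun y hy => (hR y hy).differentiableAt.differentiableWithinAt) hf.continuousWithinAt
      (Ioo_mem_nhdsGT (by linarith)) ?_
    refine Tendsto.congr' ?_ (tendsto_inf_left hg : Tendsto g (𝓝[>] x) (𝓝 (g x)))
    filter_upwards [Ioo_mem_nhdsGT (show x < x + ε by linarith)] with y hy using (hR y hy).deriv.symm
  have B : HasDerivWithinAt f (g x) (Iic x) x := by
    refine hasDerivWithinAt_Iic_of_tendsto_deriv (s := Ioo (x - ε) x)
      (fun y hy => (hL y hy).differentiableAt.differentiableWithinAt) hf.continuousWithinAt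
      (Ioo_mem_nhdsLT (by linarith)) ?_
    refine Tendsto.congr' ?_ (tendsto_inf_left hg : Tendsto g (𝓝[<] x) (𝓝 (g x)))
    filter_upwards [Ioo_mem_nhdsLT (show x - ε < x by linarith)] with y hy using (hL y hy).deriv.symm
  simpa using B.union A

/-! ### Amplitude function and tangential angle of the loop -/

section Amplitude

variable {p : ℝ}

/-- Jordan's inequality bounds the integrand near π/2 by a multiple of (π/2 - t)^(-2/p), which is
integrable because 2/p < 1. The other half follows by evenness. -/
theorem intervalIntegrable_abs_cos_rpow (hp : 2 < p) :
    IntervalIntegrable (fun t => |cos t| ^ (-(2 / p))) volume (-(π / 2)) (π / 2) := by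
  have hr : 2 / p < 1 := by rw [div_lt_one (by linarith)]; exact hp
  have hmeas : Measurable (fun t => |cos t| ^ (-(2 / p))) :=
    (continuous_cos.abs.measurable).pow_const _
  have hpi := Real.pi_pos
  have h1 : IntervalIntegrable (fun t => |cos t| ^ (-(2 / p))) volume 0 (π / 2) := by
    have hb : IntervalIntegrable (fun t => (2 / π) ^ (-(2 / p)) * (π / 2 - t) ^ (-(2 / p)))
        volume 0 (π / 2) := by
      have := (intervalIntegral.intervalIntegrable_rpow' (a := 0) (b := π / 2)
        (r := -(2 / p)) (by linarith)).comp_sub_left (π / 2)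
      simpa using (this.symm.const_mul ((2 / π) ^ (-(2 / p))))
    refine hb.mono_fun hmeas.aestronglyMeasurable ?_
    have hne : ∀ᵐ t : ℝ ∂(volume.restrict (uIoc 0 (π / 2))), t ≠ π / 2 :=
      ae_restrict_of_ae (by simp [ae_iff, measure_singleton])
    filter_upwards [hne, ae_restrict_mem measurableSet_uIoc] with t ht hmem
    rw [uIoc_of_le (by positivity)] at hmem
    have hlt : 0 < π / 2 - t := by
      have := lt_of_le_of_ne hmem.2 ht
      linarith
    have hc : 2 / π * (π / 2 - t) ≤ cos t := by
      rw [← sin_pi_div_two_sub]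
      exact mul_le_sin hlt.le (by linarith [hmem.1])
    have hpos : 0 < 2 / π * (π / 2 - t) := by positivity
    rw [← mul_rpow (by positivity) hlt.le, norm_of_nonneg (by positivity),
      norm_of_nonneg (by positivity), abs_of_pos (hpos.trans_le hc)]
    exact rpow_le_rpow_of_nonpos hpos hc (by have : 0 < 2 / p := by positivity
                                             linarith)
  have h2 : IntervalIntegrable (fun t => |cos t| ^ (-(2 / p))) volume (-(π / 2)) 0 := by
    have := h1.comp_sub_left 0
    simpa using this.symm
  exact h2.trans h1

theorem ellipticF_neg (x : ℝ) : ellipticF p (-x) = -ellipticF p x := by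
  have := intervalIntegral.integral_comp_neg (a := 0) (b := x) (fun t => |cos t| ^ (-(2 / p)))
  simp only [cos_neg, neg_zero] at this
  rw [ellipticF, ellipticF, this, intervalIntegral.integral_symm]

theorem continuousOn_ellipticF (hp : 2 < p) :
    ContinuousOn (ellipticF p) (Icc (-(π / 2)) (π / 2)) := by
  have hpi := Real.pi_pos
  have := intervalIntegral.continuousOn_primitive_interval' (a := 0)
    (intervalIntegrable_abs_cos_rpow hp) (by rw [uIcc_of_le (by linarith)]; constructor <;> linarith)
  rwa [uIcc_of_le (by linarith)] at this

theorem hasDerivAt_ellipticF (hp : 2 < p) {x : ℝ} (hx : x ∈ Ioo (-(π / 2)) (π / 2)) :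
    HasDerivAt (ellipticF p) (|cos x| ^ (-(2 / p))) x := by
  have hpi := Real.pi_pos
  have hc := cos_pos_of_mem_Ioo hx
  refine intervalIntegral.integral_hasDerivAt_right ?_ ?_ ?_
  · refine (intervalIntegrable_abs_cos_rpow hp).mono_set ?_
    rw [uIcc_of_le (a := -(π / 2)) (by linarith)]
    exact uIcc_subset_Icc ⟨by linarith, by linarith⟩ ⟨hx.1.le, hx.2.le⟩
  · exact ((continuous_cos.abs.measurable).pow_const _).stronglyMeasurable.stronglyMeasurableAtFilter
  · exact continuous_cos.abs.continuousAt.rpow_const (Or.inl (abs_pos.2 hc.ne').ne')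

theorem strictMonoOn_ellipticF (hp : 2 < p) :
    StrictMonoOn (ellipticF p) (Icc (-(π / 2)) (π / 2)) := by
  refine strictMonoOn_of_deriv_pos (convex_Icc _ _) (continuousOn_ellipticF hp) ?_
  intro x hx
  rw [interior_Icc] at hx
  rw [(hasDerivAt_ellipticF hp hx).deriv]
  exact rpow_pos_of_pos (abs_pos.2 (cos_pos_of_mem_Ioo hx).ne') _

theorem ellipticF_zero : ellipticF p 0 = 0 := by simp [ellipticF]

theorem ellipticK_pos (hp : 2 < p) : 0 < ellipticK p := by
  have hpi := Real.pi_pos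
  rw [← ellipticF_zero (p := p)]
  exact strictMonoOn_ellipticF hp ⟨by linarith, by linarith⟩ ⟨by linarith, by linarith⟩ (by linarith)

theorem image_ellipticF (hp : 2 < p) {y : ℝ} (hy : y ∈ Icc (-ellipticK p) (ellipticK p)) :
    ∃ x ∈ Icc (-(π / 2)) (π / 2), ellipticF p x = y := by
  have hpi := Real.pi_pos
  have := intermediate_value_Icc (by linarith) (continuousOn_ellipticF hp)
  rw [ellipticF_neg] at this
  exact this hy

theorem am_mem (hp : 2 < p) {y : ℝ} (hy : y ∈ Icc (-ellipticK p) (ellipticK p)) :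
    am p y ∈ Icc (-(π / 2)) (π / 2) :=
  Function.invFunOn_mem (image_ellipticF hp hy)

theorem ellipticF_am (hp : 2 < p) {y : ℝ} (hy : y ∈ Icc (-ellipticK p) (ellipticK p)) :
    ellipticF p (am p y) = y :=
  Function.invFunOn_eq (image_ellipticF hp hy)

theorem ellipticF_mem (hp : 2 < p) {x : ℝ} (hx : x ∈ Icc (-(π / 2)) (π / 2)) :
    ellipticF p x ∈ Icc (-ellipticK p) (ellipticK p) := by
  have hpi := Real.pi_pos
  rw [ellipticK, ← ellipticF_neg]
  exact ⟨(strictMonoOn_ellipticF hp).monotoneOn ⟨le_rfl, by linarith⟩ hx hx.1,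
    (strictMonoOn_ellipticF hp).monotoneOn hx ⟨by linarith, le_rfl⟩ hx.2⟩

theorem am_ellipticF (hp : 2 < p) {x : ℝ} (hx : x ∈ Icc (-(π / 2)) (π / 2)) :
    am p (ellipticF p x) = x :=
  (strictMonoOn_ellipticF hp).injOn (am_mem hp (ellipticF_mem hp hx)) hx
    (ellipticF_am hp (ellipticF_mem hp hx))

theorem strictMonoOn_am (hp : 2 < p) :
    StrictMonoOn (am p) (Icc (-ellipticK p) (ellipticK p)) := by
  intro x hx y hy hxy
  by_contra! hle
  have := (strictMonoOn_ellipticF hp).monotoneOn (am_mem hp hy) (am_mem hp hx) hle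
  rw [ellipticF_am hp hx, ellipticF_am hp hy] at this
  linarith

theorem am_neg (hp : 2 < p) {y : ℝ} (hy : y ∈ Icc (-ellipticK p) (ellipticK p)) :
    am p (-y) = -am p y := by
  have h := am_mem hp hy
  have h' : -am p y ∈ Icc (-(π / 2)) (π / 2) := ⟨by linarith [h.2], by linarith [h.1]⟩
  rw [← am_ellipticF hp h', ellipticF_neg, ellipticF_am hp hy]

theorem am_ellipticK (hp : 2 < p) : am p (ellipticK p) = π / 2 :=
  am_ellipticF hp ⟨by linarith [Real.pi_pos], le_rfl⟩

/-- The amplitude function, extended by constants beyond `± K_p`. -/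
noncomputable def amExt (p y : ℝ) : ℝ := am p (max (-ellipticK p) (min (ellipticK p) y))

theorem clamp_mem (hp : 2 < p) (y : ℝ) :
    max (-ellipticK p) (min (ellipticK p) y) ∈ Icc (-ellipticK p) (ellipticK p) :=
  ⟨le_max_left _ _, max_le (by linarith [ellipticK_pos hp]) (min_le_left _ _)⟩

theorem amExt_eq {y : ℝ} (hy : y ∈ Icc (-ellipticK p) (ellipticK p)) : amExt p y = am p y := by
  rw [amExt, min_eq_right hy.2, max_eq_right hy.1]

theorem amExt_mem (hp : 2 < p) (y : ℝ) : amExt p y ∈ Icc (-(π / 2)) (π / 2) :=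
  am_mem hp (clamp_mem hp y)

theorem amExt_of_ge (hp : 2 < p) {y : ℝ} (hy : ellipticK p ≤ y) : amExt p y = π / 2 := by
  rw [amExt, min_eq_left hy, max_eq_right (by linarith [ellipticK_pos hp]), am_ellipticK hp]

theorem amExt_of_le (hp : 2 < p) {y : ℝ} (hy : y ≤ -ellipticK p) : amExt p y = -(π / 2) := by
  have hK := ellipticK_pos hp
  rw [amExt, min_eq_right (by linarith), max_eq_left hy, am_neg hp ⟨by linarith, le_rfl⟩,
    am_ellipticK hp]

theorem monotone_amExt (hp : 2 < p) : Monotone (amExt p) := fun _ _ hxy =>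
  (strictMonoOn_am hp).monotoneOn (clamp_mem hp _) (clamp_mem hp _)
    (max_le_max le_rfl (min_le_min le_rfl hxy))

/-- A monotone map onto an interval cannot jump. -/
theorem continuous_amExt (hp : 2 < p) : Continuous (amExt p) := by
  have hpi := Real.pi_pos
  let f : ℝ → Icc (-(π / 2)) (π / 2) := fun y => ⟨amExt p y, amExt_mem hp y⟩
  have hf : Continuous f := by
    refine Monotone.continuous_of_surjective (fun x y hxy => monotone_amExt hp hxy) ?_
    rintro ⟨x, hx⟩
    refine ⟨ellipticF p x, Subtype.ext ?_⟩
    change amExt p (ellipticF p x) = x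
    rw [amExt_eq (ellipticF_mem hp hx), am_ellipticF hp hx]
  exact continuous_subtype_val.comp hf

/-- Inside this is the derivative of an inverse, outside the function is constant. The two formulas
agree at ±K_p because the cosine vanishes there and 2/p > 0. Hence the loop continues into a line
with continuous curvature. -/
theorem hasDerivAt_amExt (hp : 2 < p) (y : ℝ) :
    HasDerivAt (amExt p) (|cos (amExt p y)| ^ (2 / p)) y := by
  have hK := ellipticK_pos hp
  have h2p : 0 < 2 / p := by positivity
  have hint : ∀ y ∈ Ioo (-ellipticK p) (ellipticK p),
      HasDerivAt (amExt p) (|cos (amExt p y)| ^ (2 / p)) y := by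
    intro y hy
    have hmem : am p y ∈ Ioo (-(π / 2)) (π / 2) := by
      rw [← am_ellipticK hp, ← am_neg hp ⟨by linarith, le_rfl⟩]
      exact ⟨strictMonoOn_am hp ⟨le_rfl, by linarith⟩ (Ioo_subset_Icc_self hy) hy.1,
        strictMonoOn_am hp (Ioo_subset_Icc_self hy) ⟨by linarith, le_rfl⟩ hy.2⟩
    rw [← amExt_eq (Ioo_subset_Icc_self hy)] at hmem
    have hc := cos_pos_of_mem_Ioo hmem
    have h := HasDerivAt.of_local_left_inverse (continuous_amExt hp).continuousAt
      (hasDerivAt_ellipticF hp hmem) (rpow_pos_of_pos (abs_pos.2 hc.ne') _).ne' (by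
        filter_upwards [Ioo_mem_nhds hy.1 hy.2] with z hz
        rw [amExt_eq (Ioo_subset_Icc_self hz), ellipticF_am hp (Ioo_subset_Icc_self hz)])
    rwa [rpow_neg (abs_nonneg _), inv_inv] at h
  have hgt : ∀ y, ellipticK p < y → HasDerivAt (amExt p) (|cos (amExt p y)| ^ (2 / p)) y := by
    intro y hy
    rw [amExt_of_ge hp hy.le, cos_pi_div_two, abs_zero, zero_rpow h2p.ne']
    refine (hasDerivAt_const y (π / 2)).congr_of_eventuallyEq ?_
    filter_upwards [Ioi_mem_nhds hy] with z hz using amExt_of_ge hp (le_of_lt hz)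
  have hlt : ∀ y, y < -ellipticK p → HasDerivAt (amExt p) (|cos (amExt p y)| ^ (2 / p)) y := by
    intro y hy
    rw [amExt_of_le hp hy.le, cos_neg, cos_pi_div_two, abs_zero, zero_rpow h2p.ne']
    refine (hasDerivAt_const y (-(π / 2))).congr_of_eventuallyEq ?_
    filter_upwards [Iio_mem_nhds hy] with z hz using amExt_of_le hp (le_of_lt hz)
  have hcont : Continuous fun y => |cos (amExt p y)| ^ (2 / p) :=
    (continuous_cos.comp (continuous_amExt hp)).abs.rpow_const fun _ => Or.inr h2p.le
  have hne : ∀ y, y ≠ ellipticK p → y ≠ -ellipticK p →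
      HasDerivAt (amExt p) (|cos (amExt p y)| ^ (2 / p)) y := by
    intro y h1 h2
    rcases lt_or_gt_of_ne h1 with h1 | h1
    · rcases lt_or_gt_of_ne h2 with h2 | h2
      · exact hlt y h2
      · exact hint y ⟨h2, h1⟩
    · exact hgt y h1
  by_cases h1 : y = ellipticK p
  · refine hasDerivAt_of_eventually_ne (g := fun y => |cos (amExt p y)| ^ (2 / p)) ?_
      (continuous_amExt hp).continuousAt hcont.continuousAt
    filter_upwards [self_mem_nhdsWithin,
      nhdsWithin_le_nhds (Ioi_mem_nhds (show -ellipticK p < y by linarith))] with z hz hz'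
    exact hne z (by rw [← h1]; exact hz) (ne_of_gt hz')
  by_cases h2 : y = -ellipticK p
  · refine hasDerivAt_of_eventually_ne (g := fun y => |cos (amExt p y)| ^ (2 / p)) ?_
      (continuous_amExt hp).continuousAt hcont.continuousAt
    filter_upwards [self_mem_nhdsWithin,
      nhdsWithin_le_nhds (Iio_mem_nhds (show y < ellipticK p by linarith))] with z hz hz'
    exact hne z (ne_of_lt hz') (by rw [← h2]; exact hz)
  exact hne y h1 h2

/-- The tangential angle of the loop, extended to all of `ℝ` by the constants `0` and `2 π`. -/
noncomputable def angle (p s : ℝ) : ℝ := π + 2 * amExt p (s - ellipticK p)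

/-- The speed `θ' = 2 |sin (θ / 2)| ^ (2 / p)` at which the loop turns at tangential angle `θ`. -/
noncomputable def turnRate (p θ : ℝ) : ℝ := 2 * |sin (θ / 2)| ^ (2 / p)

theorem angle_eq_loopAngle {s : ℝ} (hs : s ∈ Icc 0 (2 * ellipticK p)) :
    angle p s = loopAngle p s := by
  rw [angle, loopAngle, amExt_eq ⟨by linarith [hs.1], by linarith [hs.2]⟩]

theorem angle_of_nonpos (hp : 2 < p) {s : ℝ} (hs : s ≤ 0) : angle p s = 0 := by
  rw [angle, amExt_of_le hp (by linarith)]; ring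

theorem angle_of_ge (hp : 2 < p) {s : ℝ} (hs : 2 * ellipticK p ≤ s) : angle p s = 2 * π := by
  rw [angle, amExt_of_ge hp (by linarith)]; ring

theorem continuous_angle (hp : 2 < p) : Continuous (angle p) := by
  have := continuous_amExt hp
  unfold angle; fun_prop

theorem angle_nonneg (hp : 2 < p) (s : ℝ) : 0 ≤ angle p s := by
  have := (amExt_mem hp (s - ellipticK p)).1
  simp only [angle]; linarith

theorem angle_le (hp : 2 < p) (s : ℝ) : angle p s ≤ 2 * π := by
  have := (amExt_mem hp (s - ellipticK p)).2
  simp only [angle]; linarith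

theorem angle_mem_Ioo (hp : 2 < p) {s : ℝ} (hs : s ∈ Ioo 0 (2 * ellipticK p)) :
    angle p s ∈ Ioo 0 (2 * π) := by
  have hK := ellipticK_pos hp
  have hy : s - ellipticK p ∈ Icc (-ellipticK p) (ellipticK p) :=
    ⟨by linarith [hs.1], by linarith [hs.2]⟩
  have h1 := strictMonoOn_am hp ⟨le_rfl, by linarith⟩ hy (by linarith [hs.1])
  have h2 := strictMonoOn_am hp hy ⟨by linarith, le_rfl⟩ (by linarith [hs.2])
  rw [am_ellipticK hp] at h2
  rw [am_neg hp ⟨by linarith, le_rfl⟩, am_ellipticK hp] at h1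
  rw [angle, amExt_eq hy]
  constructor <;> linarith

/-- Oddness of the amplitude; it allows a loop to be read backwards from its end. -/
theorem angle_reflect (hp : 2 < p) {s : ℝ} (hs : s ∈ Icc 0 (2 * ellipticK p)) :
    angle p (2 * ellipticK p - s) = 2 * π - angle p s := by
  rw [angle, angle, amExt_eq ⟨by linarith [hs.2], by linarith [hs.1]⟩,
    amExt_eq ⟨by linarith [hs.1], by linarith [hs.2]⟩,
    show 2 * ellipticK p - s - ellipticK p = -(s - ellipticK p) by ring,
    am_neg hp ⟨by linarith [hs.1], by linarith [hs.2]⟩]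
  ring

theorem continuous_turnRate (hp : 2 < p) : Continuous (turnRate p) := by
  have h2p : 0 ≤ 2 / p := by positivity
  exact continuous_const.mul
    ((continuous_sin.comp (continuous_id.div_const 2)).abs.rpow_const fun _ => Or.inr h2p)

theorem turnRate_nonneg (θ : ℝ) : 0 ≤ turnRate p θ := by unfold turnRate; positivity

theorem turnRate_le (hp : 2 < p) (θ : ℝ) : turnRate p θ ≤ 2 := by
  have := rpow_le_one (abs_nonneg _) (abs_sin_le_one (θ / 2)) (show 0 ≤ 2 / p by positivity)
  unfold turnRate; linarith

theorem turnRate_two_pi (hp : 2 < p) : turnRate p (2 * π) = 0 := by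
  have h2p : 0 < 2 / p := by positivity
  rw [turnRate, mul_div_cancel_left₀ _ two_ne_zero, sin_pi, abs_zero, zero_rpow h2p.ne', mul_zero]

/-- First integral of the elastica equation on the loop. -/
theorem turnRate_rpow (hp : 2 < p) (θ : ℝ) :
    turnRate p θ ^ p = 2 ^ (p - 1) * (1 - cos θ) := by
  have hp0 : p ≠ 0 := by linarith
  rw [turnRate, mul_rpow zero_le_two (by positivity), ← rpow_mul (abs_nonneg _),
    div_mul_cancel₀ _ hp0, rpow_two, sq_abs, rpow_sub zero_lt_two, rpow_one]
  have : cos θ = 1 - 2 * sin (θ / 2) ^ 2 := by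
    have := cos_two_mul (θ / 2)
    rw [mul_div_cancel₀ _ two_ne_zero, cos_sq'] at this
    linarith
  rw [this]; ring

theorem hasDerivAt_angle (hp : 2 < p) (s : ℝ) :
    HasDerivAt (angle p) (turnRate p (angle p s)) s := by
  have h := (((hasDerivAt_amExt hp (s - ellipticK p)).comp_sub_const s (ellipticK p)).const_mul
    2).const_add π
  have e : turnRate p (angle p s) = 2 * |cos (amExt p (s - ellipticK p))| ^ (2 / p) := by
    rw [turnRate, angle, show (π + 2 * amExt p (s - ellipticK p)) / 2 =
      amExt p (s - ellipticK p) + π / 2 by ring, sin_add_pi_div_two]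
  rw [e]; exact h

end Amplitude

/-! ### Correction functions with prescribed moments -/

section Moments

/-- The weight `min (cos x) 0` is a continuous cut-off that turns the moments into elementary
integrals. -/
theorem integral_min_cos_mul {G : ℝ → ℝ} (hG : Continuous G) :
    ∫ x in (0 : ℝ)..(2 * π), min (cos x) 0 * G x = ∫ x in (π / 2)..(3 * π / 2), cos x * G x := by
  have hpi := Real.pi_pos
  have hc : Continuous fun x => min (cos x) 0 * G x := by fun_prop
  rw [← intervalIntegral.integral_add_adjacent_intervals (hc.intervalIntegrable 0 (π / 2))
      (hc.intervalIntegrable _ _),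
    ← intervalIntegral.integral_add_adjacent_intervals (hc.intervalIntegrable (π / 2) (3 * π / 2))
      (hc.intervalIntegrable _ _)]
  have h1 : ∫ x in (0 : ℝ)..(π / 2), min (cos x) 0 * G x = 0 := by
    refine intervalIntegral.integral_zero_ae (Eventually.of_forall fun x hx => ?_)
    rw [uIoc_of_le (by linarith)] at hx
    rw [min_eq_right (cos_nonneg_of_neg_pi_div_two_le_of_le (by linarith [hx.1]) hx.2), zero_mul]
  have h2 : ∫ x in (3 * π / 2)..(2 * π), min (cos x) 0 * G x = 0 := by
    refine intervalIntegral.integral_zero_ae (Eventually.of_forall fun x hx => ?_)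
    rw [uIoc_of_le (by linarith)] at hx
    rw [← cos_sub_two_pi, min_eq_right (cos_nonneg_of_neg_pi_div_two_le_of_le
      (by linarith [hx.1]) (by linarith [hx.2])), zero_mul]
  have h3 : ∫ x in (π / 2)..(3 * π / 2), min (cos x) 0 * G x =
      ∫ x in (π / 2)..(3 * π / 2), cos x * G x := by
    refine intervalIntegral.integral_congr fun x hx => ?_
    rw [uIcc_of_le (by linarith)] at hx
    rw [min_eq_left (cos_nonpos_of_pi_div_two_le_of_le hx.1 (by linarith [hx.2]))]
  rw [h1, h2, h3]; ring

theorem cos_three_pi_div_two : cos (3 * π / 2) = 0 := by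
  rw [show 3 * π / 2 = π / 2 + π by ring, cos_add_pi, cos_pi_div_two, neg_zero]

theorem sin_three_pi_div_two : sin (3 * π / 2) = -1 := by
  rw [show 3 * π / 2 = π / 2 + π by ring, sin_add_pi, sin_pi_div_two]

/-- Functions of the angle, vanishing on the first quarter turn, with prescribed first Fourier
coefficients and zero mean. -/
theorem exists_moments : ∃ C : ℝ, 0 < C ∧ ∀ d e : ℝ, ∃ F : ℝ → ℝ, Continuous F ∧
    (∀ x ∈ Icc 0 (π / 2), F x = 0) ∧ (∀ x, |F x| ≤ C * (|d| + |e|)) ∧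
    ∫ x in (0 : ℝ)..(2 * π), F x = 0 ∧ ∫ x in (0 : ℝ)..(2 * π), F x * cos x = d ∧
    ∫ x in (0 : ℝ)..(2 * π), F x * sin x = e := by
  have hpi := Real.pi_pos
  have hpi4 : π < 3.15 := Real.pi_lt_d2
  -- `D` is the integral of cos² x (π/4 + cos x) over [π/2, 3π/2]; it is nonzero because π² < 32/3.
  set D : ℝ := π ^ 2 / 8 - 4 / 3 with hD
  have hD0 : D < 0 := by rw [hD]; nlinarith
  have hDi : 0 < -D⁻¹ := by have := inv_lt_zero.2 hD0; linarith
  refine ⟨-D⁻¹ * 2 + 3 / 2, by linarith, fun d e => ?_⟩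
  set a : ℝ := d * D⁻¹ with ha
  -- The integral of cos x sin² x over [π/2, 3π/2] is -2/3.
  set b : ℝ := -3 / 2 * e with hb
  have haD : a * D = d := by rw [ha, mul_assoc, inv_mul_cancel₀ hD0.ne, mul_one]
  have key : ∀ (G A : ℝ → ℝ), Continuous G →
      (∀ x, HasDerivAt A (cos x * ((a * (π / 4 + cos x) + b * sin x) * G x)) x) →
      ∫ x in (0 : ℝ)..(2 * π), min (cos x) 0 * (a * (π / 4 + cos x) + b * sin x) * G x =
        A (3 * π / 2) - A (π / 2) := by
    intro G A hG hA
    simp only [mul_assoc (min _ _)]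
    rw [integral_min_cos_mul (G := fun x => (a * (π / 4 + cos x) + b * sin x) * G x) (by fun_prop),
      intervalIntegral.integral_eq_sub_of_hasDerivAt (fun x _ => hA x)
        (Continuous.intervalIntegrable (by fun_prop) _ _)]
  -- The shift π/4 makes the first term have mean zero, since cos and cos² integrate to -2 and π/2
  -- over [π/2, 3π/2]. The two terms have opposite parity about π, so the moment equations decouple.
  refine ⟨fun x => min (cos x) 0 * (a * (π / 4 + cos x) + b * sin x), by fun_prop, ?_, ?_, ?_, ?_, ?_⟩
  · intro x hx
    simp only
    rw [min_eq_right (cos_nonneg_of_neg_pi_div_two_le_of_le (by linarith [hx.1]) hx.2), zero_mul]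
  · intro x
    have h1 : |min (cos x) 0| ≤ 1 := by
      rw [abs_le]
      exact ⟨le_min (neg_one_le_cos x) (by norm_num), (min_le_right _ _).trans zero_le_one⟩
    have h2 : |π / 4 + cos x| ≤ 2 := by
      rw [abs_le]; constructor <;> linarith [neg_one_le_cos x, cos_le_one x]
    have h3 := abs_sin_le_one x
    have h4 : |a| = |d| * -D⁻¹ := by
      rw [ha, abs_mul, abs_of_neg (inv_lt_zero.2 hD0)]
    have h5 : |b| = 3 / 2 * |e| := by rw [hb, abs_mul]; norm_num
    calc |min (cos x) 0 * (a * (π / 4 + cos x) + b * sin x)|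
        ≤ 1 * (|a| * 2 + |b| * 1) := by
          rw [abs_mul]
          refine mul_le_mul h1 ((abs_add_le _ _).trans ?_) (abs_nonneg _) zero_le_one
          rw [abs_mul a, abs_mul b]; gcongr
      _ ≤ _ := by
        rw [h4, h5]
        nlinarith [mul_nonneg hDi.le (abs_nonneg e), abs_nonneg d]
  · have := key (fun _ => 1) (fun x => a * (π / 4 * sin x + x / 2 + sin x * cos x / 2) +
        b * (sin x ^ 2 / 2)) (by fun_prop) (fun x => by
      have h := ((((hasDerivAt_sin x).const_mul (π / 4)).add ((hasDerivAt_id x).div_const 2)).add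
        (((hasDerivAt_sin x).mul (hasDerivAt_cos x)).div_const 2)).const_mul a |>.add
        ((((hasDerivAt_sin x).pow 2).div_const 2).const_mul b)
      refine h.congr_deriv ?_
      have := sin_sq x
      push_cast; ring_nf; rw [this]; ring)
    simp only [mul_one] at this
    rw [this, cos_three_pi_div_two, sin_three_pi_div_two, sin_pi_div_two, cos_pi_div_two]
    ring
  · rw [key cos (fun x => a * π / 4 * (x / 2 + sin x * cos x / 2) + a * (sin x - sin x ^ 3 / 3) -
        b * (cos x ^ 3 / 3)) (by fun_prop) (fun x => by
      have h := ((((hasDerivAt_id x).div_const 2).add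
        (((hasDerivAt_sin x).mul (hasDerivAt_cos x)).div_const 2)).const_mul (a * π / 4)).add
        (((hasDerivAt_sin x).sub (((hasDerivAt_sin x).pow 3).div_const 3)).const_mul a) |>.sub
        ((((hasDerivAt_cos x).pow 3).div_const 3).const_mul b)
      refine h.congr_deriv ?_
      have := sin_sq x
      push_cast; ring_nf; rw [this]; ring),
      cos_three_pi_div_two, sin_three_pi_div_two, sin_pi_div_two, cos_pi_div_two, ← haD, hD]
    ring
  · rw [key sin (fun x => a * π / 4 * (sin x ^ 2 / 2) - a * (cos x ^ 3 / 3) +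
        b * (sin x ^ 3 / 3)) (by fun_prop) (fun x => by
      have h := ((((hasDerivAt_sin x).pow 2).div_const 2).const_mul (a * π / 4)).sub
        ((((hasDerivAt_cos x).pow 3).div_const 3).const_mul a) |>.add
        ((((hasDerivAt_sin x).pow 3).div_const 3).const_mul b)
      refine h.congr_deriv ?_
      push_cast; ring),
      cos_three_pi_div_two, sin_three_pi_div_two, sin_pi_div_two, cos_pi_div_two, hb]
    ring

end Moments

/-! ### Two auxiliary facts of real analysis -/

/-- A second order upper bound for `(1 + w) ^ (-q)`. -/
theorem one_add_rpow_neg_le {q w : ℝ} (hq : 1 ≤ q) (hw : |w| ≤ 1 / (4 * q)) :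
    (1 + w) ^ (-q) ≤ 1 - q * w + (2 * q + 4 * q ^ 2) * w ^ 2 := by
  have hq0 : 0 < q := by linarith
  have hqw : q * |w| ≤ 1 / 4 := by
    calc q * |w| ≤ q * (1 / (4 * q)) := by gcongr
      _ = 1 / 4 := by field_simp
  have hw4 : |w| ≤ 1 / 4 := by nlinarith [abs_nonneg w]
  have hw4' := abs_le.1 hw4
  have hpos : 0 < 1 + w := by linarith
  set z : ℝ := q * (-w + 2 * w ^ 2) with hz
  -- From log y ≥ 1 - 1/y. Then (1 + w)^(-q) ≤ exp z, and |z| ≤ 1/2 permits exp z ≤ 1 + z + z².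
  have hlog : -w + 2 * w ^ 2 ≥ -log (1 + w) := by
    have h1 := one_sub_inv_le_log_of_pos hpos
    have h2 : (1 + w)⁻¹ ≤ 1 - w + 2 * w ^ 2 := by
      rw [inv_le_iff_one_le_mul₀ hpos]
      nlinarith [mul_nonneg (sq_nonneg w) (show 0 ≤ 1 + 2 * w by linarith)]
    linarith
  have hzabs : |z| ≤ 2 * (q * |w|) := by
    have h3 : |(-w + 2 * w ^ 2)| ≤ 2 * |w| := by
      calc |(-w + 2 * w ^ 2)| ≤ |-w| + |2 * w ^ 2| := abs_add_le _ _
        _ = |w| + 2 * |w| ^ 2 := by rw [abs_neg, abs_mul, abs_pow, abs_two]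
        _ ≤ 2 * |w| := by nlinarith [abs_nonneg w]
    rw [hz, abs_mul, abs_of_pos hq0]; nlinarith
  have hexp := (abs_le.1 (abs_exp_sub_one_sub_id_le (x := z) (by linarith))).2
  have hz2 : z ^ 2 ≤ 4 * q ^ 2 * w ^ 2 := by
    have : z ^ 2 = |z| ^ 2 := (sq_abs z).symm
    rw [this]
    calc |z| ^ 2 ≤ (2 * (q * |w|)) ^ 2 := by gcongr
      _ = 4 * q ^ 2 * |w| ^ 2 := by ring
      _ = _ := by rw [sq_abs]
  calc (1 + w) ^ (-q) = exp (log (1 + w) * -q) := rpow_def_of_pos hpos _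
    _ ≤ exp z := exp_le_exp.2 (by rw [hz]; nlinarith)
    _ ≤ 1 + z + z ^ 2 := by linarith
    _ ≤ _ := by rw [hz] at *; nlinarith

/-- Global inverse function theorem on the line. -/
theorem exists_inverse_of_deriv_ge {g g' : ℝ → ℝ} (hg : ∀ u, HasDerivAt g (g' u) u)
    (hge : ∀ u, 1 / 2 ≤ g' u) : ∃ h : ℝ → ℝ, (∀ s, g (h s) = s) ∧ (∀ u, h (g u) = u) ∧
      ∀ s, HasDerivAt h (g' (h s))⁻¹ s := by
  have hcont : Continuous g := continuous_iff_continuousAt.2 fun u => (hg u).continuousAt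
  have hmono : StrictMono g := strictMono_of_deriv_pos fun u => by
    rw [(hg u).deriv]; linarith [hge u]
  -- This gives at least linear growth in both directions, hence surjectivity.
  have hmono' : Monotone fun u => g u - u / 2 := by
    have hd : ∀ u, HasDerivAt (fun u => g u - u / 2) (g' u - 1 / 2) u := fun u =>
      (hg u).sub ((hasDerivAt_id u).div_const 2)
    refine monotone_of_deriv_nonneg (fun u => (hd u).differentiableAt) fun u => ?_
    rw [(hd u).deriv]; linarith [hge u]
  have hsurj : Function.Surjective g := by
    refine hcont.surjective ?_ ?_
    · have : Tendsto (fun u : ℝ => g 0 + u / 2) atTop atTop :=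
        tendsto_atTop_add_const_left _ _ (tendsto_id.atTop_div_const (by norm_num))
      refine tendsto_atTop_mono' _ ?_ this
      filter_upwards [eventually_ge_atTop 0] with u hu
      have := hmono' hu
      simp only at this; linarith
    · have : Tendsto (fun u : ℝ => g 0 + u / 2) atBot atBot :=
        tendsto_atBot_add_const_left _ _ (tendsto_id.atBot_div_const (by norm_num))
      refine tendsto_atBot_mono' _ ?_ this
      filter_upwards [eventually_le_atBot 0] with u hu
      have := hmono' hu
      simp only at this; linarith
  let e := hmono.orderIsoOfSurjective g hsurj
  have h1 : ∀ s, g (e.symm s) = s := fun s => e.apply_symm_apply s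
  have h2 : ∀ u, e.symm (g u) = u := fun u => e.symm_apply_apply u
  refine ⟨e.symm, h1, h2, fun s => ?_⟩
  exact HasDerivAt.of_local_left_inverse e.symm.continuous.continuousAt (hg _)
    (by linarith [hge (e.symm s)]) (Eventually.of_forall h1)

/-! ### Deforming a single loop with less energy -/

section LoopDeformation

variable {p : ℝ}

/-- Inner variation of the loop: the part of the loop over `[0, ε]` is cut off, the rest is
reparametrized in terms of a function `F` of the angle, and a segment fills up the length. -/
theorem exists_inner_variation (hp : 2 < p) {ε β : ℝ} (hε : 0 < ε) (hεK : ε ≤ 2 * ellipticK p)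
    (hεa : angle p ε ≤ π / 2) {F : ℝ → ℝ} (hF : Continuous F) (hF0 : ∀ x ∈ Icc 0 (π / 2), F x = 0)
    (hFβ : ∀ x, |F x| ≤ β) (hβ : 2 * β ≤ 1 / (4 * (p - 1)))
    (hFint : ∫ x in (0 : ℝ)..(2 * π), F x = 0) :
    ∃ (h v : ℝ → ℝ), Continuous v ∧ (∀ s, HasDerivAt h (v s) s) ∧
      (∀ s, 2 * ellipticK p ≤ s → h s = s + ε) ∧
      (∀ s, |h s - s| ≤ ε + β * (2 * π)) ∧ (∀ s, |v s - 1| ≤ 4 * β) ∧ (∀ s, 0 ≤ v s) ∧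
      (∀ G : ℝ → ℝ, Continuous G → ∫ s in (0 : ℝ)..(2 * ellipticK p), G (angle p (h s)) =
        (∫ s in (0 : ℝ)..(2 * ellipticK p), G (angle p s)) +
          (∫ s in (0 : ℝ)..ε, (G (2 * π) - G (angle p s))) + ∫ x in (0 : ℝ)..(2 * π), F x * G x) ∧
      ∫ s in (0 : ℝ)..(2 * ellipticK p), (turnRate p (angle p (h s)) * v s) ^ p ≤
        (∫ s in (0 : ℝ)..(2 * ellipticK p), turnRate p (angle p s) ^ p) +
        2 ^ (p - 1) * (-(∫ s in (0 : ℝ)..ε, (1 - cos (angle p s))) +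
          (p - 1) * (∫ x in (0 : ℝ)..(2 * π), F x * cos x) +
          16 * ellipticK p * (2 * (p - 1) + 4 * (p - 1) ^ 2) * β ^ 2) := by
  set M := 2 * ellipticK p with hM
  have hM0 : 0 < M := by have := ellipticK_pos hp; positivity
  have hpi := Real.pi_pos
  have hp1 : 0 < p - 1 := by linarith
  have hβ0 : 0 ≤ β := (abs_nonneg _).trans (hFβ 0)
  have hβ4 : 2 * β ≤ 1 / 4 := hβ.trans (by
    rw [div_le_div_iff₀ (by linarith) (by norm_num)]; linarith)
  have hac := continuous_angle hp
  have hkc : Continuous fun s => turnRate p (angle p s) := (continuous_turnRate hp).comp hac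
  have hFc : Continuous fun s => F (angle p s) := hF.comp hac
  -- Chosen so that w du = F(θ) dθ along the loop.
  set w : ℝ → ℝ := fun s => F (angle p s) * turnRate p (angle p s) with hw
  have hwc : Continuous w := hFc.mul hkc
  have hwβ : ∀ s, |w s| ≤ 2 * β := fun s => by
    rw [hw]; simp only
    rw [abs_mul, abs_of_nonneg (turnRate_nonneg _), mul_comm 2 β]
    exact mul_le_mul (hFβ _) (turnRate_le hp _) (turnRate_nonneg _) hβ0
  set Φ : ℝ → ℝ := fun x => ∫ t in (0 : ℝ)..x, F t with hΦ
  have hΦd : ∀ x, HasDerivAt Φ (F x) x := fun x => hF.integral_hasStrictDerivAt 0 x |>.hasDerivAt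
  have hΦ0 : ∀ x ∈ Icc 0 (π / 2), Φ x = 0 := fun x hx => by
    refine intervalIntegral.integral_zero_ae (Eventually.of_forall fun t ht => ?_)
    rw [uIoc_of_le hx.1] at ht
    exact hF0 t ⟨ht.1.le, ht.2.trans hx.2⟩
  -- New arclength as a function of the old one. It sends ε to 0 and is u - ε beyond the loop, so
  -- the new interval [0, M] corresponds to the old [ε, M + ε].
  set g : ℝ → ℝ := fun u => u - ε + Φ (angle p u) with hg
  have hgd : ∀ u, HasDerivAt g (1 + w u) u := fun u => by
    have := ((hasDerivAt_id u).sub_const ε).add ((hΦd (angle p u)).comp u (hasDerivAt_angle hp u))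
    exact this.congr_deriv (by simp [hw])
  have hw1c : Continuous fun u => 1 + w u := continuous_const.add hwc
  have hgge : ∀ u, 1 / 2 ≤ 1 + w u := fun u => by linarith [(abs_le.1 (hwβ u)).1]
  have hw1pos : ∀ u, 0 < 1 + w u := fun u => by linarith [hgge u]
  obtain ⟨h, hgh, hhg, hhd⟩ := exists_inverse_of_deriv_ge hgd hgge
  have hhc : Continuous h := continuous_iff_continuousAt.2 fun s => (hhd s).continuousAt
  have hvc : Continuous fun s => (1 + w (h s))⁻¹ :=
    (hw1c.comp hhc).inv₀ fun s => (hw1pos (h s)).ne'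
  have hgε : g ε = 0 := by
    simp only [hg]; rw [hΦ0 _ ⟨angle_nonneg hp _, hεa⟩]; ring
  have hgM : ∀ u, M ≤ u → g u = u - ε := fun u hu => by
    simp only [hg, hΦ]; rw [angle_of_ge hp hu, hFint]; ring
  have hcv : ∀ G : ℝ → ℝ, Continuous G →
      ∫ s in (0 : ℝ)..M, G (h s) = ∫ u in ε..(M + ε), G u * (1 + w u) := by
    intro G hG
    have := intervalIntegral.integral_comp_mul_deriv (a := ε) (b := M + ε) (f := g)
      (g := fun s => G (h s)) (fun x _ => hgd x) hw1c.continuousOn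
      (hG.comp hhc)
    rw [hgε, hgM _ (by linarith), add_sub_cancel_right] at this
    rw [← this]
    simp only [Function.comp, hhg]
  -- On [M, M + ε] the angle is constantly 2π: the removed arc is traded for a segment.
  have hshift : ∀ G : ℝ → ℝ, Continuous G → ∫ u in ε..(M + ε), G (angle p u) =
      (∫ s in (0 : ℝ)..M, G (angle p s)) + ∫ s in (0 : ℝ)..ε, (G (2 * π) - G (angle p s)) := by
    intro G hG
    have hGc : Continuous fun s => G (angle p s) := hG.comp hac
    have hi : ∀ a b, IntervalIntegrable (fun s => G (angle p s)) volume a b :=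
      fun a b => hGc.intervalIntegrable a b
    have h1 : ∫ u in M..(M + ε), G (angle p u) = ∫ s in (0 : ℝ)..ε, G (2 * π) := by
      rw [intervalIntegral.integral_congr (g := fun _ => G (2 * π)) fun x hx => ?_]
      · simp
      · rw [uIcc_of_le (by linarith)] at hx
        simp only; rw [angle_of_ge hp hx.1]
    have h2 := intervalIntegral.integral_add_adjacent_intervals (hi 0 ε) (hi ε (M + ε))
    have h3 := intervalIntegral.integral_add_adjacent_intervals (hi 0 M) (hi M (M + ε))
    rw [intervalIntegral.integral_sub (by simp) (hi _ _), ← h1]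
    linarith
  -- Substitution x = θ(u). The missing range from 0 to `angle p ε` contributes nothing, as `F`
  -- vanishes on [0, π/2].
  have hmom : ∀ G : ℝ → ℝ, Continuous G →
      ∫ u in ε..(M + ε), G (angle p u) * w u = ∫ x in (0 : ℝ)..(2 * π), F x * G x := by
    intro G hG
    have hFG : Continuous fun x => F x * G x := hF.mul hG
    have h1 := intervalIntegral.integral_comp_mul_deriv (a := ε) (b := M + ε) (f := angle p)
      (f' := fun u => turnRate p (angle p u)) (g := fun x => F x * G x)
      (fun x _ => hasDerivAt_angle hp x) hkc.continuousOn hFG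
    have h2 : ∫ x in (0 : ℝ)..(angle p ε), F x * G x = 0 := by
      refine intervalIntegral.integral_zero_ae (Eventually.of_forall fun t ht => ?_)
      rw [uIoc_of_le (angle_nonneg hp _)] at ht
      rw [hF0 t ⟨ht.1.le, ht.2.trans hεa⟩, zero_mul]
    rw [angle_of_ge hp (show M ≤ M + ε by linarith)] at h1
    rw [← intervalIntegral.integral_add_adjacent_intervals (hFG.intervalIntegrable 0 (angle p ε))
      (hFG.intervalIntegrable _ _), h2, zero_add, ← h1]
    refine intervalIntegral.integral_congr fun u _ => ?_
    simp only [hw, Function.comp]; ring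
  refine ⟨h, fun s => (1 + w (h s))⁻¹, hvc, hhd, ?_, ?_, ?_, ?_, ?_, ?_⟩
  · intro s hs
    have := hhg (s + ε)
    rwa [hgM _ (by linarith), add_sub_cancel_right] at this
  · intro s
    have h1 : h s - s = ε - Φ (angle p (h s)) := by
      have := hgh s
      simp only [hg] at this; linarith
    have h2 : |Φ (angle p (h s))| ≤ β * (2 * π) := by
      have := intervalIntegral.norm_integral_le_of_norm_le_const (a := 0) (b := angle p (h s))
        (f := F) (C := β) (fun x _ => hFβ x)
      rw [sub_zero, abs_of_nonneg (angle_nonneg hp _)] at this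
      exact this.trans (by gcongr; exact angle_le hp _)
    rw [h1]
    calc |ε - Φ (angle p (h s))| ≤ |ε| + |Φ (angle p (h s))| := abs_sub _ _
      _ ≤ _ := by rw [abs_of_pos hε]; gcongr
  · intro s
    have h1 := hgge (h s)
    have h2 := hwβ (h s)
    have h0 := hw1pos (h s)
    rw [show (1 + w (h s))⁻¹ - 1 = -w (h s) * (1 + w (h s))⁻¹ by
      field_simp [h0.ne']; ring, abs_mul, abs_neg, abs_of_pos (inv_pos.2 h0)]
    have h3 : (1 + w (h s))⁻¹ ≤ 2 := by
      rw [inv_le_comm₀ h0 (by norm_num)]; linarith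
    calc |w (h s)| * (1 + w (h s))⁻¹ ≤ 2 * β * 2 := by gcongr
      _ = _ := by ring
  · intro s
    exact (inv_pos.2 (hw1pos _)).le
  · intro G hG
    have hGc : Continuous fun s => G (angle p s) := hG.comp hac
    have hGwc : Continuous fun u => G (angle p u) * w u := hGc.mul hwc
    rw [hcv (fun s => G (angle p s)) hGc, ← hmom G hG, ← hshift G hG,
      ← intervalIntegral.integral_add (hGc.intervalIntegrable _ _)
        (hGwc.intervalIntegrable _ _)]
    refine intervalIntegral.integral_congr fun u _ => ?_
    ring
  · set q := p - 1 with hq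
    set B := 2 * q + 4 * q ^ 2 with hB
    have hB0 : 0 ≤ B := by positivity
    set e : ℝ → ℝ := fun x => 2 ^ q * (1 - cos x) with he
    have hec : Continuous e := by fun_prop
    have heac : Continuous fun s => e (angle p s) := hec.comp hac
    have he0 : ∀ x, 0 ≤ e x := fun x => by
      have := cos_le_one x
      simp only [he]; exact mul_nonneg (by positivity) (by linarith)
    have hk : ∀ s, turnRate p (angle p s) ^ p = e (angle p s) := fun s => turnRate_rpow hp _
    have hrc : Continuous fun u => (1 + w u) ^ (-q) :=
      hw1c.rpow_const fun u => Or.inl (hw1pos u).ne'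
    -- The speed contributes the power -p and the change of variables one factor 1 + w, whence the
    -- exponent -q = 1 - p.
    have hint : ∫ s in (0 : ℝ)..M, (turnRate p (angle p (h s)) * (1 + w (h s))⁻¹) ^ p =
        ∫ u in ε..(M + ε), e (angle p u) * (1 + w u) ^ (-q) := by
      have hpc : Continuous fun u => (1 + w u) ^ (-p) :=
        hw1c.rpow_const fun u => Or.inl (hw1pos u).ne'
      have := hcv (fun u => e (angle p u) * (1 + w u) ^ (-p)) (heac.mul hpc)
      rw [intervalIntegral.integral_congr (g := fun s => e (angle p (h s)) * (1 + w (h s)) ^ (-p))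
        fun s _ => ?_, this]
      · refine intervalIntegral.integral_congr fun u _ => ?_
        have h1 := hw1pos u
        rw [mul_assoc, hq, neg_sub, sub_eq_neg_add, rpow_add h1, rpow_one]
      · have h1 := hw1pos (h s)
        simp only
        rw [mul_rpow (turnRate_nonneg _) (by positivity), hk, inv_rpow h1.le, rpow_neg h1.le]
    have hle : ∫ u in ε..(M + ε), e (angle p u) * (1 + w u) ^ (-q) ≤
        ∫ u in ε..(M + ε), (e (angle p u) + -q * (e (angle p u) * w u) +
          2 ^ q * 2 * (B * (2 * β) ^ 2)) := by
      refine intervalIntegral.integral_mono_on (by linarith)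
        ((heac.mul hrc).intervalIntegrable _ _) (Continuous.intervalIntegrable (by fun_prop) _ _)
        fun u _ => ?_
      have h1 := one_add_rpow_neg_le (q := q) (by linarith) ((hwβ u).trans hβ)
      have h2 : w u ^ 2 ≤ (2 * β) ^ 2 := by
        rw [← sq_abs]; gcongr; exact hwβ u
      have h3 : e (angle p u) ≤ 2 ^ q * 2 := by
        simp only [he]; gcongr; linarith [neg_one_le_cos (angle p u)]
      calc e (angle p u) * (1 + w u) ^ (-q)
          ≤ e (angle p u) * (1 - q * w u + B * w u ^ 2) := by
            gcongr; exact he0 _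
        _ = e (angle p u) + -q * (e (angle p u) * w u) + e (angle p u) * (B * w u ^ 2) := by ring
        _ ≤ _ := by gcongr
    rw [hint]
    refine hle.trans (le_of_eq ?_)
    rw [intervalIntegral.integral_add (Continuous.intervalIntegrable (by fun_prop) _ _) (by simp),
      intervalIntegral.integral_add (Continuous.intervalIntegrable (by fun_prop) _ _)
        (Continuous.intervalIntegrable (by fun_prop) _ _), intervalIntegral.integral_const_mul (-q),
      hshift e hec, hmom e hec, intervalIntegral.integral_const]
    -- Mean zero of `F` removes the constant in 1 - cos x, so the first-order energy sees only the
    -- cosine moment.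
    have h1 : ∫ x in (0 : ℝ)..(2 * π), F x * e x =
        -(2 ^ q * ∫ x in (0 : ℝ)..(2 * π), F x * cos x) := by
      have : ∀ x, F x * e x = 2 ^ q * F x - 2 ^ q * (F x * cos x) := fun x => by
        simp only [he]; ring
      simp only [this]
      rw [intervalIntegral.integral_sub (Continuous.intervalIntegrable (by fun_prop) _ _)
        (Continuous.intervalIntegrable (by fun_prop) _ _), intervalIntegral.integral_const_mul,
        intervalIntegral.integral_const_mul, hFint]
      ring
    have h2 : ∫ s in (0 : ℝ)..ε, (e (2 * π) - e (angle p s)) =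
        -(2 ^ q * ∫ s in (0 : ℝ)..ε, (1 - cos (angle p s))) := by
      rw [← intervalIntegral.integral_const_mul, ← intervalIntegral.integral_neg]
      refine intervalIntegral.integral_congr fun s _ => ?_
      simp only [he, cos_two_pi]; ring
    rw [h1, h2]
    simp only [hk, smul_eq_mul]
    rw [hM]; ring

/-- Energy-decreasing deformations of the loop, fixing both endpoints, the tangent at the end and
arbitrarily close in `C²`. The tangent at the beginning is free. -/
theorem exists_angle_of_less_energy (hp : 2 < p) {τ : ℝ} (hτ : 0 < τ) :
    ∃ Ψ κ : ℝ → ℝ, (∀ s, HasDerivAt Ψ (κ s) s) ∧ Continuous κ ∧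
      (∀ s, 2 * ellipticK p ≤ s → Ψ s = 2 * π) ∧ (∀ s, 2 * ellipticK p ≤ s → κ s = 0) ∧
      (∀ s, |Ψ s - angle p s| ≤ τ) ∧ (∀ s, |κ s - turnRate p (angle p s)| ≤ τ) ∧
      ∫ s in (0 : ℝ)..(2 * ellipticK p), cos (Ψ s) =
        ∫ s in (0 : ℝ)..(2 * ellipticK p), cos (angle p s) ∧
      ∫ s in (0 : ℝ)..(2 * ellipticK p), sin (Ψ s) =
        ∫ s in (0 : ℝ)..(2 * ellipticK p), sin (angle p s) ∧
      ∫ s in (0 : ℝ)..(2 * ellipticK p), |κ s| ^ p <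
        ∫ s in (0 : ℝ)..(2 * ellipticK p), |turnRate p (angle p s)| ^ p := by
  have hK := ellipticK_pos hp
  have hpi := Real.pi_pos
  have hp1 : 0 < p - 1 := by linarith
  have hac := continuous_angle hp
  obtain ⟨C, hC, hmom⟩ := exists_moments
  -- `turnRate p` is not Lipschitz at 0 and 2π because 2/p < 1, so curvature closeness rests on
  -- uniform continuity.
  obtain ⟨ω, hω, huc⟩ := Metric.uniformContinuousOn_iff.1
    (isCompact_Icc.uniformContinuousOn_of_continuous
      (continuous_turnRate hp).continuousOn : UniformContinuousOn (turnRate p) (Icc 0 (2 * π)))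
    (τ / 2) (by positivity)
  set B := 2 * (p - 1) + 4 * (p - 1) ^ 2 with hB
  have hB0 : 0 < B := by positivity
  have hlip : ∀ x y, |angle p x - angle p y| ≤ 2 * |x - y| := fun x y => by
    have := convex_univ.norm_image_sub_le_of_norm_hasDerivWithin_le (f := angle p) (C := 2)
      (fun x _ => (hasDerivAt_angle hp x).hasDerivWithinAt)
      (fun x _ => by rw [norm_of_nonneg (turnRate_nonneg _)]; exact turnRate_le hp _)
      (mem_univ y) (mem_univ x)
    simpa using this
  have hsmall : ∀ A b : ℝ, 0 < b → ∀ᶠ ε : ℝ in 𝓝[>] 0, A * ε < b := fun A b hb => by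
    have : Tendsto (fun ε : ℝ => A * ε) (𝓝[>] 0) (𝓝 0) := by
      have : Continuous fun ε : ℝ => A * ε := by fun_prop
      simpa using (this.tendsto 0).mono_left nhdsWithin_le_nhds
    exact this.eventually_lt_const hb
  -- In order: the cut is shorter than the loop, it stays within a quarter turn, the expansion in w
  -- is valid, the turning rates are close, the angles are close, the speed factor is close to 1,
  -- and the quadratic remainder is below the gain p δ. The factors 3C and 8C² come from `hβε` and
  -- `hβ2`.
  obtain ⟨ε, hε1, hε2, hε3, hε4, hε5, hε6, hε7, hε⟩ :=
    ((hsmall 1 (2 * ellipticK p) (by positivity)).and <|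
    (hsmall 2 (π / 2) (by positivity)).and <|
    (hsmall (2 * (3 * C)) (1 / (4 * (p - 1))) (by positivity)).and <|
    (hsmall (2 * (1 + 3 * C * (2 * π))) ω hω).and <|
    (hsmall (2 * (1 + 3 * C * (2 * π))) τ hτ).and <|
    (hsmall (8 * (3 * C)) (τ / 2) (by positivity)).and <|
    (hsmall (16 * ellipticK p * B * (8 * C ^ 2)) p (by linarith)).and self_mem_nhdsWithin).exists
  replace hε : 0 < ε := hε
  set δ : ℝ := ∫ s in (0 : ℝ)..ε, (1 - cos (angle p s)) with hδ
  set η : ℝ := ∫ s in (0 : ℝ)..ε, sin (angle p s) with hη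
  have hcos : Continuous fun s => 1 - cos (angle p s) := by fun_prop
  have hδ0 : 0 < δ := by
    refine intervalIntegral.intervalIntegral_pos_of_pos_on (hcos.intervalIntegrable _ _) ?_ hε
    intro x hx
    have := angle_mem_Ioo hp (s := x) ⟨hx.1, by linarith [hx.2]⟩
    have hne : cos (angle p x) ≠ 1 := fun h => by
      have h0 := (cos_eq_one_iff_of_lt_of_lt (by linarith [this.1]) this.2).1 h
      exact this.1.ne' h0
    have := lt_of_le_of_ne (cos_le_one _) hne
    linarith
  have hδε : δ ≤ 2 * ε := by
    have := intervalIntegral.norm_integral_le_of_norm_le_const (a := 0) (b := ε) (C := 2)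
      (f := fun s => 1 - cos (angle p s)) (fun x _ => by
        rw [Real.norm_eq_abs, abs_le]
        constructor <;> linarith [neg_one_le_cos (angle p x), cos_le_one (angle p x)])
    rw [← hδ, sub_zero, abs_of_pos hε, norm_of_nonneg hδ0.le] at this
    exact this
  have hηε : |η| ≤ ε := by
    have := intervalIntegral.norm_integral_le_of_norm_le_const (a := 0) (b := ε) (C := 1)
      (f := fun s => sin (angle p s)) (fun x _ => abs_sin_le_one _)
    rwa [← hη, sub_zero, abs_of_pos hε, one_mul] at this
  -- Cauchy-Schwarz with sin² ≤ 2 (1 - cos), proved through a quadratic inequality in t used at its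
  -- optimum t = η / ε. Without it β² would only be O(ε²), not comparable with δ.
  have hηδ : η ^ 2 ≤ 2 * ε * δ := by
    have hquad : ∀ t : ℝ, 2 * t * η ≤ 2 * δ + t ^ 2 * ε := by
      intro t
      have h1 : ∫ s in (0 : ℝ)..ε, 2 * t * sin (angle p s) ≤
          ∫ s in (0 : ℝ)..ε, (2 * (1 - cos (angle p s)) + t ^ 2) := by
        refine intervalIntegral.integral_mono_on hε.le (Continuous.intervalIntegrable (by fun_prop) _ _)
          (Continuous.intervalIntegrable (by fun_prop) _ _) fun s _ => ?_
        have := sin_sq_add_cos_sq (angle p s)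
        nlinarith [sq_nonneg (sin (angle p s) - t), sq_nonneg (1 - cos (angle p s))]
      rw [intervalIntegral.integral_const_mul, intervalIntegral.integral_add
        (Continuous.intervalIntegrable (by fun_prop) _ _) (by simp),
        intervalIntegral.integral_const_mul, intervalIntegral.integral_const, smul_eq_mul] at h1
      linarith
    have h2 := hquad (η / ε)
    rw [show 2 * (η / ε) * η = 2 * (η ^ 2 / ε) by ring,
      show (η / ε) ^ 2 * ε = η ^ 2 / ε by field_simp] at h2
    have h3 : η ^ 2 / ε ≤ 2 * δ := by linarith
    rw [div_le_iff₀ hε] at h3; linarith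
  -- These moments cancel the displacement (δ, -η) caused by the cut.
  obtain ⟨F, hF, hF0, hFβ, hFi, hFc, hFs⟩ := hmom (-δ) η
  rw [abs_neg, abs_of_pos hδ0] at hFβ
  set β := C * (δ + |η|) with hβ
  have hβ0 : 0 ≤ β := by positivity
  have hβε : β ≤ 3 * C * ε := by
    rw [hβ]; nlinarith
  have hβ2 : β ^ 2 ≤ 8 * C ^ 2 * (ε * δ) := by
    have h1 : (δ + |η|) ^ 2 ≤ 2 * (δ ^ 2 + η ^ 2) := by
      nlinarith [sq_nonneg (δ - |η|), sq_abs η]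
    have h2 : δ ^ 2 ≤ 2 * ε * δ := by nlinarith
    calc β ^ 2 = C ^ 2 * (δ + |η|) ^ 2 := by rw [hβ]; ring
      _ ≤ C ^ 2 * (8 * (ε * δ)) := by gcongr; linarith
      _ = _ := by ring
  have hangε : angle p ε ≤ π / 2 := by
    have := hlip ε 0
    rw [angle_of_nonpos hp le_rfl, sub_zero, sub_zero, abs_of_pos hε,
      abs_of_nonneg (angle_nonneg hp _)] at this
    linarith
  obtain ⟨h, v, hv, hhd, hhM, hhs, hv1, hv0, hG, hE⟩ :=
    exists_inner_variation hp hε (by linarith) hangε hF hF0 hFβ (by linarith) hFi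
  have hkc := continuous_turnRate hp
  have hhc : Continuous h := continuous_iff_continuousAt.2 fun s => (hhd s).continuousAt
  have hnear : ∀ s, |angle p (h s) - angle p s| ≤ 2 * (1 + 3 * C * (2 * π)) * ε := fun s => by
    refine (hlip _ _).trans ?_
    have := hhs s
    have h2 : β * (2 * π) ≤ 3 * C * ε * (2 * π) := by gcongr
    linarith
  refine ⟨fun s => angle p (h s), fun s => turnRate p (angle p (h s)) * v s,
    fun s => (hasDerivAt_angle hp (h s)).comp s (hhd s), by fun_prop, ?_, ?_, ?_, ?_, ?_, ?_, ?_⟩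
  · intro s hs
    exact angle_of_ge hp (by rw [hhM s hs]; linarith)
  · intro s hs
    simp only
    rw [angle_of_ge hp (by rw [hhM s hs]; linarith), turnRate_two_pi hp, zero_mul]
  · intro s
    exact (hnear s).trans hε5.le
  · intro s
    have h1 := huc (angle p (h s)) ⟨angle_nonneg hp _, angle_le hp _⟩ (angle p s)
      ⟨angle_nonneg hp _, angle_le hp _⟩ (by rw [Real.dist_eq]; exact (hnear s).trans_lt hε4)
    rw [Real.dist_eq] at h1
    have h2 : |turnRate p (angle p (h s)) * (v s - 1)| ≤ 2 * (4 * β) := by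
      rw [abs_mul, abs_of_nonneg (turnRate_nonneg _)]
      exact mul_le_mul (turnRate_le hp _) (hv1 s) (abs_nonneg _) zero_le_two
    calc |turnRate p (angle p (h s)) * v s - turnRate p (angle p s)|
        = |turnRate p (angle p (h s)) * (v s - 1) +
          (turnRate p (angle p (h s)) - turnRate p (angle p s))| := by congr 1; ring
      _ ≤ 2 * (4 * β) + τ / 2 := (abs_add_le _ _).trans (add_le_add h2 h1.le)
      _ ≤ τ := by linarith
  · rw [hG cos continuous_cos, hFc, cos_two_pi, ← hδ]; ring
  · rw [hG sin continuous_sin, hFs, sin_two_pi]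
    simp only [zero_sub]
    rw [intervalIntegral.integral_neg, ← hη]; ring
  · have h1 : ∀ s, |turnRate p (angle p (h s)) * v s| = turnRate p (angle p (h s)) * v s :=
      fun s => abs_of_nonneg (mul_nonneg (turnRate_nonneg _) (hv0 s))
    simp only [h1, abs_of_nonneg (turnRate_nonneg _)]
    refine hE.trans_lt ?_
    rw [hFc]
    have h2 : 16 * ellipticK p * B * β ^ 2 < p * δ := by
      calc 16 * ellipticK p * B * β ^ 2 ≤ 16 * ellipticK p * B * (8 * C ^ 2 * (ε * δ)) := by gcongr
        _ = 16 * ellipticK p * B * (8 * C ^ 2) * ε * δ := by ring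
        _ < p * δ := by gcongr
    have h3 : (0 : ℝ) < 2 ^ (p - 1) := by positivity
    have h4 := mul_neg_of_pos_of_neg h3 (show -δ + (p - 1) * -δ + 16 * ellipticK p * B * β ^ 2 < 0
      by linarith)
    linarith

end LoopDeformation

/-! ### Concatenations near a junction or an end of a loop -/

/-- The unit tangent of tangential angle `τ Ψ(|x|)`. -/
noncomputable def tangent (τ : ℝ) (Ψ : ℝ → ℝ) (x : ℝ) : ℂ :=
  Complex.exp (Complex.I * ((τ * Ψ |x| : ℝ) : ℂ))

section Chain

variable {p : ℝ}

theorem continuous_tangent (τ : ℝ) {Ψ : ℝ → ℝ} (hΨ : Continuous Ψ) :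
    Continuous (tangent τ Ψ) := by
  unfold tangent; fun_prop

theorem Curve.append_of_le {γ₁ γ₂ : Curve} {s : ℝ} (hs : s ≤ γ₁.len) :
    (γ₁.append γ₂).toFun s = γ₁.toFun s := if_pos hs

theorem Curve.append_add {γ₁ γ₂ : Curve} {x : ℝ} (hx : 0 ≤ x) :
    (γ₁.append γ₂).toFun (γ₁.len + x) = γ₂.toFun x + γ₁.toFun γ₁.len - γ₂.toFun 0 := by
  rcases hx.eq_or_lt with rfl | hx
  · rw [add_zero, Curve.append_of_le le_rfl]; ring
  · simp only [Curve.append]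
    rw [if_neg (by linarith), add_sub_cancel_left]

/-- Conjugation negates the angle, so a factor σ covers both orientations. -/
theorem loop_eq (σ : ℤˣ) {x : ℝ} (hx : x ∈ Icc 0 (2 * ellipticK p)) :
    (loop p σ).toFun x = ∫ t in (0 : ℝ)..x, tangent ((σ : ℤ) : ℝ) (angle p) t := by
  have hcongr : ∀ t ∈ uIcc 0 x, loopAngle p t = angle p |t| := fun t ht => by
    rw [uIcc_of_le hx.1] at ht
    rw [abs_of_nonneg ht.1, angle_eq_loopAngle ⟨ht.1, ht.2.trans hx.2⟩]
  rcases Int.units_eq_one_or σ with rfl | rfl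
  · simp only [loop, if_true, tangent]
    refine intervalIntegral.integral_congr fun t ht => ?_
    simp [hcongr t ht]
  · have : ((-1 : ℤˣ) = 1) = False := by decide
    simp only [loop, this, if_false, tangent]
    rw [← intervalIntegral.intervalIntegral_conj]
    refine intervalIntegral.integral_congr fun t ht => ?_
    simp [← Complex.exp_conj, hcongr t ht]

theorem chain_len_succ (σ : ℕ → ℤˣ) (ℓ : ℕ → ℝ) (n : ℕ) :
    (chain p σ ℓ (n + 1)).len = (chain p σ ℓ n).len + (2 * ellipticK p + ℓ (n + 1)) := rfl

theorem monotone_chain_len (hp : 2 < p) (σ : ℕ → ℤˣ) {ℓ : ℕ → ℝ} (hℓ : ∀ i, 0 ≤ ℓ i) :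
    Monotone fun n => (chain p σ ℓ n).len :=
  monotone_nat_of_le_succ fun n => by
    rw [chain_len_succ]; linarith [ellipticK_pos hp, hℓ (n + 1)]

theorem chain_of_le (hp : 2 < p) (σ : ℕ → ℤˣ) {ℓ : ℕ → ℝ} (hℓ : ∀ i, 0 ≤ ℓ i) {n N : ℕ}
    (hn : n ≤ N) {s : ℝ} (hs : s ≤ (chain p σ ℓ n).len) :
    (chain p σ ℓ N).toFun s = (chain p σ ℓ n).toFun s := by
  induction N, hn using Nat.le_induction with
  | base => rfl
  | succ N hN ih =>
    rw [← ih]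
    exact Curve.append_of_le (hs.trans (monotone_chain_len hp σ hℓ hN))

/-- A concatenation just after the beginning of a loop. -/
theorem chain_loopStart_add (hp : 2 < p) (σ : ℕ → ℤˣ) {ℓ : ℕ → ℝ} (hℓ : ∀ i, 0 ≤ ℓ i) {j N : ℕ}
    (hj : j < N) {x : ℝ} (hx : x ∈ Icc 0 (2 * ellipticK p)) :
    (chain p σ ℓ N).toFun ((chain p σ ℓ j).len + x) =
      (chain p σ ℓ N).toFun (chain p σ ℓ j).len +
        ∫ t in (0 : ℝ)..x, tangent ((σ j : ℤ) : ℝ) (angle p) t := by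
  have hK := ellipticK_pos hp
  have hle : (chain p σ ℓ j).len + x ≤ (chain p σ ℓ (j + 1)).len := by
    rw [chain_len_succ]; linarith [hx.2, hℓ (j + 1)]
  rw [chain_of_le hp σ hℓ (show j + 1 ≤ N from hj) hle, chain_of_le hp σ hℓ hj.le le_rfl]
  have h0 : (loop p (σ j)).toFun 0 = 0 := by
    rw [loop_eq _ ⟨le_rfl, by linarith⟩, intervalIntegral.integral_same]
  have e1 : ((loop p (σ j)).append (seg (ℓ (j + 1)))).toFun x = (loop p (σ j)).toFun x :=
    Curve.append_of_le hx.2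
  have e2 : ((loop p (σ j)).append (seg (ℓ (j + 1)))).toFun 0 = (loop p (σ j)).toFun 0 :=
    Curve.append_of_le (show (0 : ℝ) ≤ 2 * ellipticK p by linarith)
  rw [chain, Curve.append_add hx.1, e1, e2, h0, loop_eq _ hx]
  ring

/-- A concatenation just before the end of a loop. -/
theorem chain_loopStop_add (hp : 2 < p) (σ : ℕ → ℤˣ) {ℓ : ℕ → ℝ} (hℓ : ∀ i, 0 ≤ ℓ i) {j N : ℕ}
    (hj : j < N) {x : ℝ} (hx : x ∈ Icc (-(2 * ellipticK p)) 0) :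
    (chain p σ ℓ N).toFun ((chain p σ ℓ j).len + 2 * ellipticK p + x) =
      (chain p σ ℓ N).toFun ((chain p σ ℓ j).len + 2 * ellipticK p) +
        ∫ t in (0 : ℝ)..x, tangent (-((σ j : ℤ) : ℝ)) (angle p) t := by
  have hK := ellipticK_pos hp
  have hc := continuous_tangent ((σ j : ℤ) : ℝ) (continuous_angle hp)
  rw [add_assoc, chain_loopStart_add hp σ hℓ hj ⟨by linarith [hx.1], by linarith [hx.2]⟩,
    chain_loopStart_add hp σ hℓ hj ⟨by linarith, le_rfl⟩, add_assoc]
  congr 1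
  rw [← intervalIntegral.integral_add_adjacent_intervals (hc.intervalIntegrable 0 (2 * ellipticK p))
    (hc.intervalIntegrable _ _)]
  congr 1
  have := intervalIntegral.integral_comp_add_left (a := 0) (b := x)
    (tangent ((σ j : ℤ) : ℝ) (angle p)) (2 * ellipticK p)
  rw [add_zero] at this
  rw [← this]
  refine intervalIntegral.integral_congr fun t ht => ?_
  rw [uIcc_of_ge hx.2] at ht
  have h1 : |2 * ellipticK p + t| = 2 * ellipticK p - |t| := by
    rw [abs_of_nonpos ht.2, abs_of_nonneg (by linarith [ht.1, hx.1])]; ring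
  -- Read backwards the angle is σ (2π - Θ), which is -σ Θ up to σ full turns; hence the opposite
  -- sign in the statement.
  simp only [tangent]
  rw [h1, angle_reflect hp ⟨abs_nonneg _, by rw [abs_of_nonpos ht.2]; linarith [ht.1, hx.1]⟩,
    Complex.exp_eq_exp_iff_exists_int]
  exact ⟨(σ j : ℤ), by push_cast; ring⟩

end Chain

/-! ### Estimates for tangents and their derivatives -/

theorem norm_tangent (τ : ℝ) (Ψ : ℝ → ℝ) (x : ℝ) : ‖tangent τ Ψ x‖ = 1 := by
  rw [tangent, mul_comm]; exact Complex.norm_exp_ofReal_mul_I _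

theorem norm_exp_I_mul_sub_le (a b : ℝ) :
    ‖Complex.exp (Complex.I * a) - Complex.exp (Complex.I * b)‖ ≤ |a - b| := by
  have h : Complex.exp (Complex.I * a) - Complex.exp (Complex.I * b) =
      Complex.exp (b * Complex.I) * (Complex.exp (Complex.I * ((a - b : ℝ) : ℂ)) - 1) := by
    rw [mul_sub, ← Complex.exp_add, mul_one]
    congr 1
    · congr 1; push_cast; ring
    · rw [mul_comm]
  rw [h, norm_mul, Complex.norm_exp_ofReal_mul_I, one_mul]
  exact Real.norm_exp_I_mul_ofReal_sub_one_le

theorem norm_tangent_sub_tangent_le {τ : ℝ} (hτ : |τ| = 1) (Ψ Θ : ℝ → ℝ) (x y : ℝ) :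
    ‖tangent τ Ψ x - tangent τ Θ y‖ ≤ |Ψ (|x|) - Θ (|y|)| := by
  refine (norm_exp_I_mul_sub_le _ _).trans (le_of_eq ?_)
  rw [← mul_sub, abs_mul, hτ, one_mul]

/-- The derivative of `tangent τ Ψ` away from the origin, where `κ = Ψ'`. -/
noncomputable def tangentDeriv (τ : ℝ) (Ψ κ : ℝ → ℝ) (x : ℝ) : ℂ :=
  ((τ * (κ |x| * (SignType.sign x : ℝ)) : ℝ) : ℂ) * (Complex.I * tangent τ Ψ x)

theorem hasDerivAt_tangent (τ : ℝ) {Ψ κ : ℝ → ℝ} (hΨ : ∀ s, HasDerivAt Ψ (κ s) s) {x : ℝ}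
    (hx : x ≠ 0) : HasDerivAt (tangent τ Ψ) (tangentDeriv τ Ψ κ x) x := by
  have h := ((((hΨ |x|).comp x (hasDerivAt_abs hx)).const_mul τ).ofReal_comp.const_mul
    Complex.I).cexp
  exact h.congr_deriv (by simp only [tangentDeriv, tangent, Function.comp]; ring)

theorem measurable_sign_real : Measurable fun x : ℝ => ((SignType.sign x : SignType) : ℝ) := by
  have : (fun x : ℝ => ((SignType.sign x : SignType) : ℝ)) =
      fun x => if 0 < x then 1 else if x < 0 then -1 else 0 := by
    funext x
    rw [sign_apply]
    split_ifs <;> simp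
  rw [this]
  exact Measurable.ite measurableSet_Ioi measurable_const
    (Measurable.ite measurableSet_Iio measurable_const measurable_const)

theorem measurable_tangentDeriv (τ : ℝ) {Ψ κ : ℝ → ℝ} (hΨ : Continuous Ψ) (hκ : Continuous κ) :
    Measurable (tangentDeriv τ Ψ κ) := by
  have h1 : Measurable fun x : ℝ => τ * (κ |x| * (SignType.sign x : ℝ)) :=
    ((hκ.comp continuous_abs).measurable.mul measurable_sign_real).const_mul τ
  exact (Complex.measurable_ofReal.comp h1).mul
    ((continuous_tangent τ hΨ).measurable.const_mul Complex.I)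

theorem abs_sign_le (x : ℝ) : |((SignType.sign x : SignType) : ℝ)| ≤ 1 := by
  rcases lt_trichotomy x 0 with h | rfl | h
  · simp [sign_neg h]
  · simp
  · simp [sign_pos h]

/-- Product-rule splitting into a change of curvature and a change of direction. -/
theorem norm_tangentDeriv_sub_le {τ : ℝ} (hτ : |τ| = 1) (Ψ Θ κ k : ℝ → ℝ) (x : ℝ) :
    ‖tangentDeriv τ Ψ κ x - tangentDeriv τ Θ k x‖ ≤
      |κ (|x|) - k (|x|)| + |k (|x|)| * |Ψ (|x|) - Θ (|x|)| := by
  have h : tangentDeriv τ Ψ κ x - tangentDeriv τ Θ k x =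
      ((τ * (SignType.sign x : ℝ) : ℝ) : ℂ) * Complex.I *
      (((κ |x| - k |x| : ℝ) : ℂ) * tangent τ Ψ x +
        (k |x| : ℂ) * (tangent τ Ψ x - tangent τ Θ x)) := by
    simp only [tangentDeriv]; push_cast; ring
  rw [h, norm_mul, norm_mul, Complex.norm_real, Complex.norm_I, mul_one, norm_mul, norm_eq_abs,
    hτ, one_mul]
  refine (mul_le_of_le_one_left (norm_nonneg _) (abs_sign_le x)).trans ?_
  refine (norm_add_le _ _).trans ?_
  rw [norm_mul, norm_mul, Complex.norm_real, Complex.norm_real, norm_tangent, mul_one]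
  gcongr
  · exact le_of_eq (norm_eq_abs _)
  · exact le_of_eq (norm_eq_abs _)
  · exact norm_tangent_sub_tangent_le hτ _ _ _ _

theorem hasDerivAt_isometry (rot : ℂ ≃ₗᵢ[ℝ] ℂ) {f : ℝ → ℂ} {f' : ℂ} {s : ℝ}
    (hf : HasDerivAt f f' s) : HasDerivAt (fun s => rot (f s)) (rot f') s :=
  (rot.toContinuousLinearEquiv : ℂ →L[ℝ] ℂ).hasFDerivAt.comp_hasDerivAt s hf

theorem hasDerivAt_affine (A c s : ℝ) : HasDerivAt (fun s => A + c * s) c s := by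
  simpa using ((hasDerivAt_id s).const_mul c).const_add A

/-- Derivative of a rescaled and rotated arclength parametrization. -/
theorem hasDerivAt_rescaled {T : ℝ → ℂ} (hT : Continuous T) (rot : ℂ ≃ₗᵢ[ℝ] ℂ) {c : ℝ} (hc : 0 < c)
    (A s : ℝ) : HasDerivAt (fun s => c⁻¹ • rot (∫ t in (0 : ℝ)..(A + c * s), T t))
      (rot (T (A + c * s))) s := by
  have h1 : HasDerivAt (fun x => ∫ t in (0 : ℝ)..x, T t) (T (A + c * s)) (A + c * s) :=
    (hT.integral_hasStrictDerivAt 0 _).hasDerivAt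
  have h2 := (hasDerivAt_isometry rot (h1.scomp s (hasDerivAt_affine A c s))).const_smul c⁻¹
  exact h2.congr_deriv (by rw [map_smul, smul_smul, inv_mul_cancel₀ hc.ne', one_smul])

/-! ### Derivatives and curvature near the touching point -/

section Local

variable {L c A M τ : ℝ} {rot : ℂ ≃ₗᵢ[ℝ] ℂ} {b : ℂ} {Ψ κ : ℝ → ℝ} {ξ : ℝ → ℂ}

theorem eventually_near {s : ℝ} (hsM : |A + c * s| < M) :
    ∀ᶠ t in 𝓝[Icc 0 L] s, t ∈ Icc 0 L ∧ |A + c * t| < M := by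
  have hcont : Continuous fun t : ℝ => |A + c * t| := by fun_prop
  exact (eventually_mem_nhdsWithin).and
    (nhdsWithin_le_nhds (hcont.continuousAt.eventually_lt_const hsM))

theorem d1_eq_of_local (hL : 0 < L) (hc : 0 < c) (hΨ : Continuous Ψ)
    (hξ : ∀ s ∈ Icc 0 L, |A + c * s| < M →
      ξ s = c⁻¹ • rot (∫ t in (0 : ℝ)..(A + c * s), tangent τ Ψ t) + b)
    {s : ℝ} (hs : s ∈ Icc 0 L) (hsM : |A + c * s| < M) :
    d1 L ξ s = rot (tangent τ Ψ (A + c * s)) := by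
  have h := ((hasDerivAt_rescaled (continuous_tangent τ hΨ) rot hc A s).add_const b).hasDerivWithinAt
    (s := Icc 0 L)
  refine (h.congr_of_eventuallyEq ?_ (hξ s hs hsM)).derivWithin (uniqueDiffOn_Icc hL s hs)
  filter_upwards [eventually_near hsM] with t ht using hξ t ht.1 ht.2

theorem d2_eq_of_local (hL : 0 < L) (hc : 0 < c) (hΨ : ∀ s, HasDerivAt Ψ (κ s) s)
    (hξ : ∀ s ∈ Icc 0 L, |A + c * s| < M →
      ξ s = c⁻¹ • rot (∫ t in (0 : ℝ)..(A + c * s), tangent τ Ψ t) + b)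
    {s : ℝ} (hs : s ∈ Icc 0 L) (hsM : |A + c * s| < M) (hs0 : A + c * s ≠ 0) :
    d2 L ξ s = c • rot (tangentDeriv τ Ψ κ (A + c * s)) := by
  have hΨc : Continuous Ψ := continuous_iff_continuousAt.2 fun s => (hΨ s).continuousAt
  have h := (hasDerivAt_isometry rot ((hasDerivAt_tangent τ hΨ hs0).scomp s
    (hasDerivAt_affine A c s))).hasDerivWithinAt (s := Icc 0 L)
  rw [map_smul] at h
  refine (h.congr_of_eventuallyEq ?_ (d1_eq_of_local hL hc hΨc hξ hs hsM)).derivWithin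
    (uniqueDiffOn_Icc hL s hs)
  filter_upwards [eventually_near hsM] with t ht using d1_eq_of_local hL hc hΨc hξ ht.1 ht.2

/-- A linear isometry of the plane is a rotation or a reflection followed by a rotation, and
preserves determinants up to sign. -/
theorem abs_im_conj_isometry_mul (rot : ℂ ≃ₗᵢ[ℝ] ℂ) (r : ℝ) {T : ℂ} (hT : ‖T‖ = 1) :
    |(starRingEnd ℂ (rot T) * rot ((r : ℂ) * (Complex.I * T))).im| = |r| := by
  have hTT : starRingEnd ℂ T * T = 1 := by
    rw [mul_comm, Complex.mul_conj, Complex.normSq_eq_norm_sq, hT]; simp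
  obtain ⟨a, rfl | rfl⟩ := linear_isometry_complex rot
  · have ha : starRingEnd ℂ (a : ℂ) * a = 1 := by
      rw [mul_comm, Complex.mul_conj, Complex.normSq_eq_norm_sq, Circle.norm_coe]; simp
    have : starRingEnd ℂ (rotation a T) * rotation a ((r : ℂ) * (Complex.I * T)) =
        (starRingEnd ℂ (a : ℂ) * a) * (starRingEnd ℂ T * T) * (r * Complex.I) := by
      simp only [rotation_apply, map_mul]; ring
    rw [this, ha, hTT]; simp
  · have ha : starRingEnd ℂ (a : ℂ) * a = 1 := by
      rw [mul_comm, Complex.mul_conj, Complex.normSq_eq_norm_sq, Circle.norm_coe]; simp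
    have : starRingEnd ℂ ((Complex.conjLIE.trans (rotation a)) T) *
        (Complex.conjLIE.trans (rotation a)) ((r : ℂ) * (Complex.I * T)) =
        (starRingEnd ℂ (a : ℂ) * a) * (starRingEnd ℂ T * T) * (-(r * Complex.I)) := by
      simp only [LinearIsometryEquiv.trans_apply, rotation_apply, Complex.conjLIE_apply, map_mul,
        Complex.conj_conj, Complex.conj_ofReal, Complex.conj_I]
      ring
    rw [this, ha, hTT]; simp

theorem abs_signedCurvature_of_local (hL : 0 < L) (hc : 0 < c) (hτ : |τ| = 1)
    (hΨ : ∀ s, HasDerivAt Ψ (κ s) s)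
    (hξ : ∀ s ∈ Icc 0 L, |A + c * s| < M →
      ξ s = c⁻¹ • rot (∫ t in (0 : ℝ)..(A + c * s), tangent τ Ψ t) + b)
    {s : ℝ} (hs : s ∈ Icc 0 L) (hsM : |A + c * s| < M) (hs0 : A + c * s ≠ 0) :
    |signedCurvature L ξ s| = c * |κ (|A + c * s|)| := by
  have hΨc : Continuous Ψ := continuous_iff_continuousAt.2 fun s => (hΨ s).continuousAt
  rw [signedCurvature, d1_eq_of_local hL hc hΨc hξ hs hsM, d2_eq_of_local hL hc hΨ hξ hs hsM hs0,
    mul_smul_comm, Complex.smul_im, smul_eq_mul, abs_mul, abs_of_pos hc, tangentDeriv,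
    abs_im_conj_isometry_mul rot _ (norm_tangent _ _ _), abs_mul, hτ, one_mul, abs_mul]
  have : |((SignType.sign (A + c * s) : SignType) : ℝ)| = 1 := by
    rcases lt_or_gt_of_ne hs0 with h | h
    · simp [sign_neg h]
    · simp [sign_pos h]
  rw [this, mul_one]

end Local

/-! ### Primitives of even, compactly supported functions -/

section EvenIntegrals

variable {E : Type*} [NormedAddCommGroup E] [NormedSpace ℝ E] {f : ℝ → E} {M : ℝ}

theorem integral_eq_of_ge (hf : Continuous f) (h0 : ∀ x, M ≤ x → f x = 0) {x : ℝ} (hx : M ≤ x) :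
    ∫ t in (0 : ℝ)..x, f t = ∫ t in (0 : ℝ)..M, f t := by
  rw [← intervalIntegral.integral_add_adjacent_intervals (hf.intervalIntegrable 0 M)
    (hf.intervalIntegrable M x), intervalIntegral.integral_zero_ae (a := M), add_zero]
  refine Eventually.of_forall fun t ht => ?_
  rw [uIoc_of_le hx] at ht
  exact h0 t ht.1.le

theorem integral_eq_neg_of_le (hf : Continuous f) (h0 : ∀ x, M ≤ x → f x = 0)
    (heven : ∀ x, f (-x) = f x) {x : ℝ} (hx : x ≤ -M) :
    ∫ t in (0 : ℝ)..x, f t = -∫ t in (0 : ℝ)..M, f t := by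
  rw [← integral_eq_of_ge hf h0 (show M ≤ -x by linarith)]
  have := intervalIntegral.integral_comp_neg (a := 0) (b := -x) f
  simp only [heven, neg_neg, neg_zero] at this
  rw [this, intervalIntegral.integral_symm]

end EvenIntegrals

theorem tangent_neg (τ : ℝ) (Ψ : ℝ → ℝ) (x : ℝ) : tangent τ Ψ (-x) = tangent τ Ψ x := by
  rw [tangent, abs_neg, tangent]

theorem integral_tangent {τ : ℝ} (hτ : |τ| = 1) {Ψ : ℝ → ℝ} (hΨ : Continuous Ψ) {M : ℝ}
    (hM : 0 ≤ M) : ∫ t in (0 : ℝ)..M, tangent τ Ψ t =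
      ((∫ t in (0 : ℝ)..M, cos (Ψ t) : ℝ) : ℂ) +
        ((∫ t in (0 : ℝ)..M, sin (Ψ t) : ℝ) : ℂ) * (τ * Complex.I) := by
  have h : ∀ t ∈ uIcc 0 M, tangent τ Ψ t =
      ((cos (Ψ t) : ℝ) : ℂ) + ((sin (Ψ t) : ℝ) : ℂ) * (τ * Complex.I) := by
    intro t ht
    rw [uIcc_of_le hM] at ht
    rw [tangent, abs_of_nonneg ht.1, mul_comm, Complex.exp_mul_I, ← Complex.ofReal_cos,
      ← Complex.ofReal_sin]
    rcases (abs_eq zero_le_one).1 hτ with rfl | rfl <;> simp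
  rw [intervalIntegral.integral_congr h, intervalIntegral.integral_add
    (Continuous.intervalIntegrable (by fun_prop) _ _)
    (Continuous.intervalIntegrable (by fun_prop) _ _), intervalIntegral.integral_mul_const,
    intervalIntegral.integral_ofReal, intervalIntegral.integral_ofReal]

theorem abs_sub_le_of_deriv_le {Ψ κ : ℝ → ℝ} (hΨ : ∀ s, HasDerivAt Ψ (κ s) s) {C : ℝ}
    (hC : ∀ s, |κ s| ≤ C) (x y : ℝ) : |Ψ x - Ψ y| ≤ C * |x - y| := by
  simpa using convex_univ.norm_image_sub_le_of_norm_hasDerivWithin_le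
    (fun x _ => (hΨ x).hasDerivWithinAt) (fun x _ => hC x) (mem_univ y) (mem_univ x)

theorem norm_tangent_sub_le {τ : ℝ} (hτ : |τ| = 1) {Ψ κ : ℝ → ℝ}
    (hΨ : ∀ s, HasDerivAt Ψ (κ s) s) {C : ℝ} (hC : ∀ s, |κ s| ≤ C) (x y : ℝ) :
    ‖tangent τ Ψ x - tangent τ Ψ y‖ ≤ C * |x - y| := by
  have hC0 : 0 ≤ C := (abs_nonneg _).trans (hC 0)
  refine (norm_tangent_sub_tangent_le hτ _ _ _ _).trans
    ((abs_sub_le_of_deriv_le hΨ hC _ _).trans ?_)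
  exact mul_le_mul_of_nonneg_left (abs_abs_sub_abs_le_abs_sub x y) hC0

/-- Off the interval all three derivatives take the default value 0. Equality of functions allows
rewriting inside absolute continuity. -/
theorem d1_add {L : ℝ} {γ u : ℝ → ℂ} (hγ : DifferentiableOn ℝ γ (Icc 0 L))
    (hu : DifferentiableOn ℝ u (Icc 0 L)) : d1 L (γ + u) = d1 L γ + d1 L u := by
  funext s
  by_cases hs : s ∈ Icc 0 L
  · exact derivWithin_add (hγ s hs) (hu s hs)
  · have h : s ∉ closure (Icc 0 L) := by rwa [isClosed_Icc.closure_eq]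
    simp only [d1, Pi.add_apply, derivWithin_zero_of_notMem_closure h, add_zero]

/-- At unit speed the curvature is bounded by |γ''|, which is in L^p. Integrability makes the
comparison of energies additive. -/
theorem intervalIntegrable_signedCurvature {p L : ℝ} (hp : 0 < p) (hL : 0 < L) {γ : ℝ → ℂ}
    (hγ : MemW2p p L γ) (hγ1 : ∀ s ∈ Icc 0 L, ‖d1 L γ s‖ = 1) :
    IntervalIntegrable (fun s => |signedCurvature L γ s| ^ p) volume 0 L := by
  rw [intervalIntegrable_iff_integrableOn_Icc_of_le hL.le]
  have h1 := hγ.memLp.integrable_norm_rpow (by simpa using hp) ENNReal.ofReal_ne_top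
  rw [ENNReal.toReal_ofReal hp.le] at h1
  have hd1 : AEStronglyMeasurable (d1 L γ) (volume.restrict (Icc 0 L)) := by
    have := hγ.absolutelyContinuous.continuousOn
    rw [uIcc_of_le hL.le] at this
    exact this.aestronglyMeasurable measurableSet_Icc
  have hsc : AEStronglyMeasurable (signedCurvature L γ) (volume.restrict (Icc 0 L)) :=
    Complex.continuous_im.comp_aestronglyMeasurable
      ((Complex.continuous_conj.comp_aestronglyMeasurable hd1).mul hγ.memLp.1)
  have hpow : Continuous fun x : ℝ => |x| ^ p :=
    continuous_abs.rpow_const fun _ => Or.inr hp.le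
  refine h1.mono' (hpow.comp_aestronglyMeasurable hsc) ?_
  filter_upwards [ae_restrict_mem measurableSet_Icc] with s hs
  rw [norm_of_nonneg (by positivity)]
  gcongr
  refine (Complex.abs_im_le_norm _).trans ?_
  rw [norm_mul, RCLike.norm_conj, hγ1 s hs, one_mul]

/-! ### Competitors of lower energy and the conclusion -/

/-- A pinned curve which near the parameter `-A / c` consists of two opposite loops meeting there,
or of one loop beginning or ending there at an endpoint of the curve, is unstable. -/
theorem not_isStable_of_local {p L : ℝ} (hp : 2 < p) (hL : 0 < L) {P₀ P₁ : ℂ} {γ : ℝ → ℂ}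
    (hγ : γ ∈ pinnedClass p L P₀ P₁) {A c τ : ℝ} (hc : 0 < c) (hτ : |τ| = 1)
    {rot : ℂ ≃ₗᵢ[ℝ] ℂ} {b : ℂ} (hA : A ≤ -(2 * ellipticK p) ∨ A = 0)
    (hB : 2 * ellipticK p ≤ A + c * L ∨ A + c * L = 0)
    (hγloc : ∀ s ∈ Icc 0 L, |A + c * s| < 2 * ellipticK p →
      γ s = c⁻¹ • rot (∫ t in (0 : ℝ)..(A + c * s), tangent τ (angle p) t) + b) :
    ¬ IsStable p L P₀ P₁ γ := by
  rintro ⟨-, δ, hδ, hmin⟩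
  have hK := ellipticK_pos hp
  set M := 2 * ellipticK p with hM
  have hM0 : 0 < M := by positivity
  have hp0 : 0 < p := by linarith
  obtain ⟨hγW, hγ1, hγ0, hγL⟩ := hγ
  -- The L^p norm of the constant 1. The terms c⁻¹M, 1 and 3c below bound the changes of γ, γ' and
  -- γ'' relative to ε.
  set V : ENNReal := (volume.restrict (Icc 0 L)) univ ^ (ENNReal.ofReal p).toReal⁻¹ with hV
  have hVtop : V ≠ ⊤ := ENNReal.rpow_ne_top_of_nonneg (by positivity) (by simp)
  obtain ⟨ε, hεδ, hε⟩ : ∃ ε : ℝ, V * ENNReal.ofReal ((c⁻¹ * M + 1 + 3 * c) * ε) < δ ∧ 0 < ε := by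
    have hcont : Continuous fun ε : ℝ => V * ENNReal.ofReal ((c⁻¹ * M + 1 + 3 * c) * ε) :=
      (ENNReal.continuous_const_mul hVtop).comp (ENNReal.continuous_ofReal.comp (by fun_prop))
    have ht := (hcont.tendsto 0).mono_left (nhdsWithin_le_nhds (s := Ioi 0))
    simp only [mul_zero, ENNReal.ofReal_zero] at ht
    exact ((ht.eventually_lt_const hδ).and self_mem_nhdsWithin).exists
  obtain ⟨Ψ, κ, hΨ, hκ, hΨM, hκM, hΨε, hκε, hcos, hsin, hlt⟩ := exists_angle_of_less_energy hp hε
  set k : ℝ → ℝ := fun s => turnRate p (angle p s) with hk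
  have hΘ : ∀ s, HasDerivAt (angle p) (k s) s := hasDerivAt_angle hp
  have hkc : Continuous k := (continuous_turnRate hp).comp (continuous_angle hp)
  have hkM : ∀ s, M ≤ s → k s = 0 := fun s hs => by
    simp only [hk]; rw [angle_of_ge hp hs, turnRate_two_pi hp]
  have hk2 : ∀ s, |k s| ≤ 2 := fun s => by
    rw [abs_of_nonneg (turnRate_nonneg _)]; exact turnRate_le hp _
  have hκ2 : ∀ s, |κ s| ≤ 2 + ε := fun s => by
    have h1 := hκε s
    have h2 := hk2 s
    have h3 := abs_add_le (k s) (κ s - k s)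
    rw [add_sub_cancel] at h3
    exact h3.trans (add_le_add h2 h1)
  have hΨc : Continuous Ψ := continuous_iff_continuousAt.2 fun s => (hΨ s).continuousAt
  have hΘc := continuous_angle hp
  -- the variation of the tangent, in the coordinate centred at the touching point
  set f : ℝ → ℂ := fun x => tangent τ Ψ x - tangent τ (angle p) x with hf
  have hfc : Continuous f := (continuous_tangent τ hΨc).sub (continuous_tangent τ hΘc)
  have hfeven : ∀ x, f (-x) = f x := fun x => by simp only [hf, tangent_neg]
  have hf0 : ∀ x, M ≤ |x| → f x = 0 := fun x hx => by
    simp only [hf, tangent]; rw [hΨM _ hx, angle_of_ge hp hx, sub_self]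
  have hf0' : ∀ x, M ≤ x → f x = 0 := fun x hx => hf0 x (hx.trans (le_abs_self x))
  have hfε : ∀ x, ‖f x‖ ≤ ε := fun x =>
    (norm_tangent_sub_tangent_le hτ _ _ _ _).trans (hΨε _)
  -- The deformed loop has the same endpoint displacement. With evenness, the variation of the curve
  -- vanishes beyond distance M on both sides.
  have hfM : ∫ t in (0 : ℝ)..M, f t = 0 := by
    simp only [hf]
    rw [intervalIntegral.integral_sub ((continuous_tangent τ hΨc).intervalIntegrable _ _)
      ((continuous_tangent τ hΘc).intervalIntegrable _ _), integral_tangent hτ hΨc hM0.le,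
      integral_tangent hτ hΘc hM0.le, hcos, hsin, sub_self]
  have hU0 : ∀ x, M ≤ |x| → ∫ t in (0 : ℝ)..x, f t = 0 := by
    intro x hx
    rcases le_abs.1 hx with h | h
    · rw [integral_eq_of_ge hfc hf0' h, hfM]
    · rw [integral_eq_neg_of_le hfc hf0' hfeven (by linarith), hfM, neg_zero]
  have hUε : ∀ x, ‖∫ t in (0 : ℝ)..x, f t‖ ≤ M * ε := by
    intro x
    rcases le_total M |x| with h | h
    · rw [hU0 x h, norm_zero]; positivity
    · refine (intervalIntegral.norm_integral_le_of_norm_le_const fun t _ => hfε t).trans ?_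
      rw [sub_zero, mul_comm]; gcongr
  set u : ℝ → ℂ := fun s => c⁻¹ • rot (∫ t in (0 : ℝ)..(A + c * s), f t) with hu
  have hud : ∀ s, HasDerivAt u (rot (f (A + c * s))) s := hasDerivAt_rescaled hfc rot hc A
  have hudiff : DifferentiableOn ℝ u (Icc 0 L) := fun s _ =>
    (hud s).differentiableAt.differentiableWithinAt
  have hd1u : ∀ s ∈ Icc 0 L, d1 L u s = rot (f (A + c * s)) := fun s hs =>
    (hud s).hasDerivWithinAt.derivWithin (uniqueDiffOn_Icc hL s hs)
  have hd1 : d1 L (γ + u) = d1 L γ + d1 L u := d1_add hγW.differentiableOn hudiff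
  have hd1' : ∀ s ∈ Icc 0 L, d1 L (γ + u) s = d1 L γ s + rot (f (A + c * s)) := fun s hs => by
    rw [hd1, Pi.add_apply, hd1u s hs]
  have hξloc : ∀ s ∈ Icc 0 L, |A + c * s| < M →
      (γ + u) s = c⁻¹ • rot (∫ t in (0 : ℝ)..(A + c * s), tangent τ Ψ t) + b := by
    intro s hs hsM
    simp only [Pi.add_apply, hu, hf]
    rw [hγloc s hs hsM, intervalIntegral.integral_sub
      ((continuous_tangent τ hΨc).intervalIntegrable _ _)
      ((continuous_tangent τ hΘc).intervalIntegrable _ _), map_sub, smul_sub]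
    ring
  -- Discards the touching point, where the new curvature may jump, and the far ends of the loops.
  have hgood : ∀ᵐ s : ℝ, A + c * s ≠ 0 ∧ |A + c * s| ≠ M := by
    have hfin : ({-A / c, (M - A) / c, (-M - A) / c} : Set ℝ).Finite := by simp
    filter_upwards [hfin.countable.ae_notMem volume] with s hs
    simp only [mem_insert_iff, mem_singleton_iff, not_or, eq_div_iff hc.ne'] at hs
    refine ⟨fun h => hs.1 (by linarith), fun h => ?_⟩
    rcases (abs_eq hM0.le).1 h with h | h
    · exact hs.2.1 (by linarith)
    · exact hs.2.2 (by linarith)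
  have hfar : ∀ s ∈ Icc 0 L, M < |A + c * s| →
      d1 L (γ + u) s = d1 L γ s ∧ d2 L (γ + u) s = d2 L γ s := by
    intro s hs hsM
    have h1 : ∀ t ∈ Icc 0 L, M < |A + c * t| → d1 L (γ + u) t = d1 L γ t := fun t ht htM => by
      rw [hd1' t ht, hf0 _ htM.le, map_zero, add_zero]
    refine ⟨h1 s hs hsM, Filter.EventuallyEq.derivWithin_eq ?_ (h1 s hs hsM)⟩
    have hcont : Continuous fun t : ℝ => |A + c * t| := by fun_prop
    filter_upwards [self_mem_nhdsWithin,
      nhdsWithin_le_nhds (hcont.continuousAt.eventually_const_lt hsM)] with t ht htM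
    exact h1 t ht htM
  set W : ℝ → ℂ := fun s => c • rot (tangentDeriv τ Ψ κ (A + c * s) -
    tangentDeriv τ (angle p) k (A + c * s)) with hW
  have hd2 : ∀ᵐ s ∂(volume.restrict (Icc 0 L)), d2 L (γ + u) s = d2 L γ s + W s := by
    filter_upwards [ae_restrict_of_ae hgood, ae_restrict_mem measurableSet_Icc] with s hs hmem
    rcases lt_or_gt_of_ne hs.2 with h | h
    · rw [d2_eq_of_local hL hc hΨ hξloc hmem h hs.1, d2_eq_of_local hL hc hΘ hγloc hmem h hs.1]
      simp only [hW]
      rw [map_sub, smul_sub]; ring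
    · rw [(hfar s hmem h).2]
      simp only [hW, tangentDeriv]
      rw [hκM _ h.le, hkM _ h.le]; simp
  have hWε : ∀ s, ‖W s‖ ≤ 3 * c * ε := fun s => by
    simp only [hW]
    rw [norm_smul, norm_of_nonneg hc.le, LinearIsometryEquiv.norm_map]
    have h1 := norm_tangentDeriv_sub_le hτ Ψ (angle p) κ k (A + c * s)
    have h2 : |k (|A + c * s|)| * |Ψ (|A + c * s|) - angle p (|A + c * s|)| ≤ 2 * ε :=
      mul_le_mul (hk2 _) (hΨε _) (abs_nonneg _) zero_le_two
    have h3 := hκε (|A + c * s|)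
    calc c * _ ≤ c * (ε + 2 * ε) := by gcongr; exact h1.trans (add_le_add h3 h2)
      _ = _ := by ring
  have hWm : Measurable W := by
    have h1 : Measurable fun s : ℝ => A + c * s := by fun_prop
    exact ((rot.continuous.measurable.comp (((measurable_tangentDeriv τ hΨc hκ).comp h1).sub
      ((measurable_tangentDeriv τ hΘc hkc).comp h1)))).const_smul c
  have hξW : MemW2p p L (γ + u) := by
    refine ⟨hγW.differentiableOn.add hudiff, ?_, ?_⟩
    · rw [hd1]
      refine hγW.absolutelyContinuous.add ?_
      -- Both tangents are Lipschitz even across the touching point, as they depend on |x|.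
      refine LipschitzOnWith.absolutelyContinuousOnInterval
        (K := Real.toNNReal ((2 + ε + 2) * c)) (LipschitzOnWith.of_dist_le_mul fun s hs t ht => ?_)
      rw [uIcc_of_le hL.le] at hs ht
      rw [Real.coe_toNNReal _ (by positivity), hd1u s hs, hd1u t ht, rot.dist_map, dist_eq_norm,
        Real.dist_eq]
      have h1 := norm_tangent_sub_le hτ hΨ hκ2 (A + c * s) (A + c * t)
      have h2 := norm_tangent_sub_le hτ hΘ hk2 (A + c * s) (A + c * t)
      rw [show A + c * s - (A + c * t) = c * (s - t) by ring, abs_mul, abs_of_pos hc] at h1 h2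
      calc ‖f (A + c * s) - f (A + c * t)‖
          = ‖(tangent τ Ψ (A + c * s) - tangent τ Ψ (A + c * t)) -
            (tangent τ (angle p) (A + c * s) - tangent τ (angle p) (A + c * t))‖ := by
            simp only [hf]; congr 1; ring
        _ ≤ (2 + ε) * (c * |s - t|) + 2 * (c * |s - t|) :=
            (norm_sub_le _ _).trans (add_le_add h1 h2)
        _ = _ := by ring
    · refine MemLp.ae_eq (f := fun s => d2 L γ s + W s) ?_ (hγW.memLp.add
        (MemLp.of_bound hWm.aestronglyMeasurable (3 * c * ε) (Eventually.of_forall hWε)))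
      filter_upwards [hd2] with s hs using hs.symm
  have hξ1 : ∀ s ∈ Icc 0 L, ‖d1 L (γ + u) s‖ = 1 := by
    intro s hs
    rcases lt_or_ge |A + c * s| M with h | h
    · rw [d1_eq_of_local hL hc hΨc hξloc hs h, rot.norm_map, norm_tangent]
    · rw [hd1' s hs, hf0 _ h, map_zero, add_zero, hγ1 s hs]
  have hu0 : u 0 = 0 := by
    have : ∫ t in (0 : ℝ)..A, f t = 0 := by
      rcases hA with h | rfl
      · exact hU0 A (by rw [le_abs]; right; linarith)
      · exact intervalIntegral.integral_same
    simp [hu, this]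
  have huL : u L = 0 := by
    have : ∫ t in (0 : ℝ)..(A + c * L), f t = 0 := by
      rcases hB with h | h
      · exact hU0 _ (h.trans (le_abs_self _))
      · rw [h, intervalIntegral.integral_same]
    simp [hu, this]
  have hξ : γ + u ∈ pinnedClass p L P₀ P₁ :=
    ⟨hξW, hξ1, by rw [Pi.add_apply, hu0, add_zero, hγ0], by rw [Pi.add_apply, huL, add_zero, hγL]⟩
  have hdist : w2pDist p L γ (γ + u) < δ := by
    refine lt_of_le_of_lt ?_ hεδ
    have e1 : eLpNorm (fun s => γ s - (γ + u) s) (ENNReal.ofReal p) (volume.restrict (Icc 0 L)) ≤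
        V * ENNReal.ofReal (c⁻¹ * M * ε) := by
      refine eLpNorm_le_of_ae_bound (Eventually.of_forall fun s => ?_)
      rw [Pi.add_apply, sub_add_cancel_left, norm_neg]
      simp only [hu]
      rw [norm_smul, rot.norm_map, norm_of_nonneg (by positivity), mul_assoc]
      gcongr
      exact hUε _
    have e2 : eLpNorm (fun s => d1 L γ s - d1 L (γ + u) s) (ENNReal.ofReal p)
        (volume.restrict (Icc 0 L)) ≤ V * ENNReal.ofReal (1 * ε) := by
      refine eLpNorm_le_of_ae_bound ?_
      filter_upwards [ae_restrict_mem measurableSet_Icc] with s hs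
      rw [hd1' s hs, sub_add_cancel_left, norm_neg, rot.norm_map, one_mul]
      exact hfε _
    have e3 : eLpNorm (fun s => d2 L γ s - d2 L (γ + u) s) (ENNReal.ofReal p)
        (volume.restrict (Icc 0 L)) ≤ V * ENNReal.ofReal (3 * c * ε) := by
      refine eLpNorm_le_of_ae_bound ?_
      filter_upwards [hd2] with s hs
      rw [hs, sub_add_cancel_left, norm_neg]
      exact hWε s
    refine (add_le_add (add_le_add e1 e2) e3).trans (le_of_eq ?_)
    rw [← mul_add, ← mul_add, ← ENNReal.ofReal_add (by positivity) (by positivity),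
      ← ENNReal.ofReal_add (by positivity) (by positivity)]
    congr 2; ring
  set G : ℝ → ℝ := fun x => c ^ p * (|κ (|x|)| ^ p - |k (|x|)| ^ p) with hG
  have hGc : Continuous G :=
    continuous_const.mul (((hκ.comp continuous_abs).abs.rpow_const fun _ => Or.inr hp0.le).sub
      ((hkc.comp continuous_abs).abs.rpow_const fun _ => Or.inr hp0.le))
  have hGeven : ∀ x, G (-x) = G x := fun x => by simp only [hG, abs_neg]
  have hG0 : ∀ x, M ≤ |x| → G x = 0 := fun x hx => by
    simp only [hG]; rw [hκM _ hx, hkM _ hx, sub_self, mul_zero]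
  have hG0' : ∀ x, M ≤ x → G x = 0 := fun x hx => hG0 x (hx.trans (le_abs_self x))
  have hGM : ∫ t in (0 : ℝ)..M, G t < 0 := by
    have h1 : ∫ t in (0 : ℝ)..M, G t = ∫ t in (0 : ℝ)..M, c ^ p * (|κ t| ^ p - |k t| ^ p) := by
      refine intervalIntegral.integral_congr fun t ht => ?_
      rw [uIcc_of_le hM0.le] at ht
      simp only [hG]; rw [abs_of_nonneg ht.1]
    rw [h1, intervalIntegral.integral_const_mul, intervalIntegral.integral_sub
      ((hκ.abs.rpow_const fun _ => Or.inr hp0.le).intervalIntegrable _ _)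
      ((hkc.abs.rpow_const fun _ => Or.inr hp0.le).intervalIntegrable _ _)]
    exact mul_neg_of_pos_of_neg (by positivity) (by linarith)
  -- Each nonempty side contributes one full loop's energy drop. The two sides cannot both be empty
  -- because c L > 0.
  have hGL : ∫ s in (0 : ℝ)..L, G (A + c * s) < 0 := by
    rw [intervalIntegral.integral_comp_add_mul _ hc.ne', mul_zero, add_zero,
      ← intervalIntegral.integral_interval_sub_left (hGc.intervalIntegrable 0 _)
      (hGc.intervalIntegrable 0 _), smul_eq_mul]
    refine mul_neg_of_pos_of_neg (by positivity) ?_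
    have hcL : 0 < c * L := by positivity
    rcases hA with h | h
    · rw [integral_eq_neg_of_le hGc hG0' hGeven h]
      rcases hB with h' | h'
      · rw [integral_eq_of_ge hGc hG0' h']; linarith
      · rw [h', intervalIntegral.integral_same]; linarith
    · rcases hB with h' | h'
      · rw [integral_eq_of_ge hGc hG0' h', h, intervalIntegral.integral_same]; linarith
      · linarith
  have hE : bendingEnergy p L (γ + u) =
      bendingEnergy p L γ + ∫ s in (0 : ℝ)..L, G (A + c * s) := by
    have hGAc : Continuous fun s => G (A + c * s) := hGc.comp (by fun_prop)
    rw [bendingEnergy, bendingEnergy, ← intervalIntegral.integral_add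
      (intervalIntegrable_signedCurvature hp0 hL hγW hγ1)
      (hGAc.intervalIntegrable _ _)]
    refine intervalIntegral.integral_congr_ae ?_
    filter_upwards [hgood] with s hs hmem
    rw [uIoc_of_le hL.le] at hmem
    replace hmem := Ioc_subset_Icc_self hmem
    rcases lt_or_gt_of_ne hs.2 with h | h
    · rw [abs_signedCurvature_of_local hL hc hτ hΨ hξloc hmem h hs.1,
        abs_signedCurvature_of_local hL hc hτ hΘ hγloc hmem h hs.1,
        mul_rpow hc.le (abs_nonneg _), mul_rpow hc.le (abs_nonneg _)]
      simp only [hG]; ring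
    · rw [signedCurvature, (hfar s hmem h).1, (hfar s hmem h).2, ← signedCurvature]
      have : G (A + c * s) = 0 := hG0 _ h.le
      simp [this]
  have := hmin _ hξ hdist
  linarith

theorem not_isStable_of_loops {p L : ℝ} (hp : 2 < p) (hL : 0 < L) {P₀ P₁ : ℂ} {γ : ℝ → ℂ}
    (hγ : γ ∈ pinnedClass p L P₀ P₁) (D : Presentation p L γ)
    (h : D.HasAdjacentOppositeLoops ∨ D.LoopTouchesEndpoint) : ¬ IsStable p L P₀ P₁ γ := by
  have hK := ellipticK_pos hp
  have hunit : ∀ σ : ℤˣ, |((σ : ℤ) : ℝ)| = 1 := fun σ => by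
    rcases Int.units_eq_one_or σ with rfl | rfl <;> simp
  -- it suffices to expand the concatenation at the touching point
  have key : ∀ J τ : ℝ, |τ| = 1 →
      (D.start - J ≤ -(2 * ellipticK p) ∨ D.start - J = 0) →
      (2 * ellipticK p ≤ D.start - J + D.scale * L ∨ D.start - J + D.scale * L = 0) →
      (∀ x, |x| < 2 * ellipticK p → D.start - J ≤ x → x ≤ D.start - J + D.scale * L →
        (chain p D.σ D.ℓ D.numLoops).toFun (J + x) = (chain p D.σ D.ℓ D.numLoops).toFun J +
          ∫ t in (0 : ℝ)..x, tangent τ (angle p) t) → ¬ IsStable p L P₀ P₁ γ := by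
    intro J τ hτ hA hB hx
    refine not_isStable_of_local hp hL hγ D.scale_pos hτ hA hB (rot := D.rot)
      (b := D.scale⁻¹ • D.rot ((chain p D.σ D.ℓ D.numLoops).toFun J) + D.shift) fun s hs hsM => ?_
    have h1 := mul_nonneg D.scale_pos.le hs.1
    have h2 := mul_le_mul_of_nonneg_left hs.2 D.scale_pos.le
    rw [D.eq_chain s hs, show D.start + D.scale * s = J + (D.start - J + D.scale * s) by ring,
      hx _ hsM (by linarith) (by linarith), map_add, smul_add]
    ring
  have hforward : ∀ j, D.ContainsLoop j → ∀ x ∈ Icc 0 (2 * ellipticK p), _ := fun j hj x hx =>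
    chain_loopStart_add hp D.σ D.ℓ_nonneg hj.1 hx
  have hbackward : ∀ j, D.ContainsLoop j → ∀ x ∈ Icc (-(2 * ellipticK p)) 0, _ := fun j hj x hx =>
    chain_loopStop_add hp D.σ D.ℓ_nonneg hj.1 hx
  have hlen : ∀ j, D.loopStop j = D.loopStart j + 2 * ellipticK p := fun j => rfl
  rcases h with ⟨j, hj, hj', hℓ, hσ⟩ | ⟨j, hj, h | h⟩
  -- The zero-length segment makes the end of one loop the start of the next, and opposite signs
  -- make the backward expansion of the first match the forward expansion of the second.
  · have hJ : D.loopStart (j + 1) = D.loopStart j + 2 * ellipticK p := by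
      rw [Presentation.loopStart, chain_len_succ, hℓ, add_zero]; rfl
    have hσ' : ((D.σ (j + 1) : ℤ) : ℝ) = -((D.σ j : ℤ) : ℝ) := by
      rcases Int.units_eq_one_or (D.σ j) with h1 | h1 <;>
      rcases Int.units_eq_one_or (D.σ (j + 1)) with h2 | h2 <;> simp_all
    have h1 := hj.2.1
    have h2 := hj'.2.2
    rw [hlen] at h2
    refine key (D.loopStart (j + 1)) _ (hunit (D.σ (j + 1))) (Or.inl (by linarith))
      (Or.inl (by linarith)) fun x hxM _ _ => ?_
    rw [abs_lt] at hxM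
    rcases le_total 0 x with h0 | h0
    · exact hforward _ hj' x ⟨h0, hxM.2.le⟩
    · rw [hσ', hJ]
      exact hbackward j hj x ⟨hxM.1.le, h0⟩
  · have h1 := hj.2.2
    rw [hlen] at h1
    refine key (D.loopStart j) _ (hunit (D.σ j)) (Or.inr (by linarith)) (Or.inl (by linarith))
      fun x hxM h2 _ => ?_
    rw [abs_lt] at hxM
    exact hforward j hj x ⟨by linarith, hxM.2.le⟩
  · have h1 := hj.2.1
    rw [hlen] at h
    refine key (D.loopStart j + 2 * ellipticK p) (-((D.σ j : ℤ) : ℝ))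
      (by rw [abs_neg, hunit]) (Or.inl (by linarith)) (Or.inr (by linarith)) fun x hxM _ h2 => ?_
    rw [abs_lt] at hxM
    exact hbackward j hj x ⟨hxM.1.le, by linarith⟩

end FlatCore

/-- A flat-core planar `p`-elastica in a pinned class is unstable if it contains two adjacent
loops in opposite directions with no segment between them, or if a loop touches an endpoint. -/
theorem theorem2p12 (p : ℝ) (hp : 2 < p) (L : ℝ) (hL : 0 < L) (P₀ P₁ : ℂ) (hP : dist P₀ P₁ < L)
    (γ : ℝ → ℂ) (hγ : γ ∈ FlatCore.pinnedClass p L P₀ P₁) (D : FlatCore.Presentation p L γ)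
    (h : D.HasAdjacentOppositeLoops ∨ D.LoopTouchesEndpoint) :
    ¬ FlatCore.IsStable p L P₀ P₁ γ :=
  FlatCore.not_isStable_of_loops hp hL hγ D h
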